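/- For integers $a,b,c\ge 4$ let $FCS_{a,b,c}$ (the zigzag-edge coronoid fused with a starphene) be the following finite simple graph. Its vertices are $p_{1,d},p_{2,d}$ $(1\le d\le 2a-1)$; $q_{1,d},q_{2,d}$ $(1\le d\le 2c-1)$; $r_{1,d},r_{2,d}$ $(1\le d\le 2b-1)$; $s_{1,d},s_{2,d}$ $(1\le d\le 2a-3)$; $t_{1,d},t_{2,d}$ $(1\le d\le 2c-3)$; $u_{1,d},u_{2,d}$ $(1\le d\le 2b-3)$; $p_{3,d},s_{3,d}$ $(1\le d\le 2a-5)$; $q_{3,d},t_{3,d}$ $(1\le d\le 2c-5)$; $r_{3,d},u_{3,d}$ $(1\le d\le 2b-5)$. Its edges are: (i) $x_{m,d}\,x_{m,d+1}$ for each $x\in\{p,q,r,s,t,u\}$, $m\in\{1,2,3\}$ and all $d$ for which both vertices exist; (ii) for $m\in\{1,2\}$: $p_{m,2d}\,s_{m,2d-1}$ $(1\le d\le a-1)$, $q_{m,2d}\,t_{m,2d-1}$ $(1\le d\le c-1)$, $r_{m,2d}\,u_{m,2d-1}$ $(1\le d\le b-1)$; (iii) $p_{3,2d-1}\,s_{3,2d-1}$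 $(1\le d\le a-2)$, $q_{3,2d-1}\,t_{3,2d-1}$ $(1\le d\le c-2)$, $r_{3,2d-1}\,u_{3,2d-1}$ $(1\le d\le b-2)$; (iv) $p_{3,1}r_{3,1}$, $q_{3,1}u_{3,1}$, $s_{3,1}t_{3,1}$; (v) $p_{3,2a-5}\,t_{2,2c-4}$, $s_{3,2a-5}\,u_{2,2}$, $q_{3,2c-5}\,u_{1,2b-4}$, $t_{3,2c-5}\,s_{2,2a-4}$, $r_{3,2b-5}\,s_{1,2a-4}$, $u_{3,2b-5}\,t_{1,2}$; (vi) $p_{1,1}q_{2,1}$, $s_{1,1}t_{2,1}$, $p_{1,2a-1}q_{1,1}$, $s_{1,2a-3}t_{1,1}$, $q_{1,2c-1}r_{1,1}$, $t_{1,2c-3}u_{1,1}$, $r_{1,2b-1}p_{2,2a-1}$, $u_{1,2b-3}s_{2,2a-3}$, $p_{2,1}r_{2,2b-1}$, $s_{2,1}u_{2,2b-3}$, $r_{2,1}q_{2,2c-1}$, $u_{2,1}t_{2,2c-3}$. A set $U$ of vertices of a connected graph is a metric generator (resolving set) if for any two distinct vertices $x,y$ there is $u\in U$ with $d(u,x)\ne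 d(u,y)$, where $d$ is the shortest-path distance; the metric dimension is the minimum cardinality of a metric generator. **Theorem 1.** For all integers $a,b,c\ge 4$, the metric dimension of $FCS_{a,b,c}$ is exactly $3$. -/

import Mathlib

/-- A set `U` of vertices is a metric generator (resolving set) of the graph `G` if every two
distinct vertices of `G` have different distances to some element of `U`. -/
def SimpleGraph.IsMetricGenerator {V : Type*} (G : SimpleGraph V) (U : Set V) : Prop :=
  ∀ x y : V, x ≠ y → ∃ u ∈ U, G.dist u x ≠ G.dist u y

/-- The metric dimension of a connected graph: the minimum cardinality of a metric generator. -/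
noncomputable def SimpleGraph.metricDim {V : Type*} (G : SimpleGraph V) : ℕ∞ :=
  ⨅ (U : Set V) (_ : G.IsMetricGenerator U), U.encard

/-- The eighteen families of vertices `p₁, p₂, p₃, q₁, …, u₃` of the zigzag-edge coronoid fused
with a starphene. The families `p₁ q₁ r₁ p₂ r₂ q₂` form the outer boundary of the coronoid, the
families `s₁ t₁ u₁ s₂ u₂ t₂` its inner boundary, and `p₃, s₃`, `q₃, t₃`, `r₃, u₃` are the sides of
the three arms of the starphene. -/
inductive FCSLine : Type
  | p1 | p2 | p3
  | q1 | q2 | q3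
  | r1 | r2 | r3
  | s1 | s2 | s3
  | t1 | t2 | t3
  | u1 | u2 | u3

/-- The number of vertices in each family (meaningful for `a, b, c ≥ 4`). -/
def FCSLine.len (a b c : ℕ) : FCSLine → ℕ
  | .p1 => 2 * a - 1
  | .p2 => 2 * a - 1
  | .q1 => 2 * c - 1
  | .q2 => 2 * c - 1
  | .r1 => 2 * b - 1
  | .r2 => 2 * b - 1
  | .s1 => 2 * a - 3
  | .s2 => 2 * a - 3
  | .t1 => 2 * c - 3
  | .t2 => 2 * c - 3
  | .u1 => 2 * b - 3
  | .u2 => 2 * b - 3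
  | .p3 => 2 * a - 5
  | .s3 => 2 * a - 5
  | .q3 => 2 * c - 5
  | .t3 => 2 * c - 5
  | .r3 => 2 * b - 5
  | .u3 => 2 * b - 5

/-- The vertices: `(x, d)` with `x` a family and `1 ≤ d ≤ len x`. -/
def FCSVertex (a b c : ℕ) : Type :=
  {v : FCSLine × ℕ // 1 ≤ v.2 ∧ v.2 ≤ FCSLine.len a b c v.1}

/-- The edges, each listed in one direction. -/
inductive FCSEdge (a b c : ℕ) : FCSLine × ℕ → FCSLine × ℕ → Prop
  /- consecutive vertices of one family -/
  | path (x : FCSLine) (d : ℕ) (h₁ : 1 ≤ d) (h₂ : d + 1 ≤ x.len a b c) :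
      FCSEdge a b c (x, d) (x, d + 1)
  /- the edges between the outer and the inner boundary of the coronoid -/
  | p1s1 (d : ℕ) (h₁ : 1 ≤ d) (h₂ : d ≤ a - 1) : FCSEdge a b c (.p1, 2 * d) (.s1, 2 * d - 1)
  | p2s2 (d : ℕ) (h₁ : 1 ≤ d) (h₂ : d ≤ a - 1) : FCSEdge a b c (.p2, 2 * d) (.s2, 2 * d - 1)
  | q1t1 (d : ℕ) (h₁ : 1 ≤ d) (h₂ : d ≤ c - 1) : FCSEdge a b c (.q1, 2 * d) (.t1, 2 * d - 1)
  | q2t2 (d : ℕ) (h₁ : 1 ≤ d) (h₂ : d ≤ c - 1) : FCSEdge a b c (.q2, 2 * d) (.t2, 2 * d - 1)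
  | r1u1 (d : ℕ) (h₁ : 1 ≤ d) (h₂ : d ≤ b - 1) : FCSEdge a b c (.r1, 2 * d) (.u1, 2 * d - 1)
  | r2u2 (d : ℕ) (h₁ : 1 ≤ d) (h₂ : d ≤ b - 1) : FCSEdge a b c (.r2, 2 * d) (.u2, 2 * d - 1)
  /- the edges between the two sides of an arm of the starphene -/
  | p3s3 (d : ℕ) (h₁ : 1 ≤ d) (h₂ : d ≤ a - 2) :
      FCSEdge a b c (.p3, 2 * d - 1) (.s3, 2 * d - 1)
  | q3t3 (d : ℕ) (h₁ : 1 ≤ d) (h₂ : d ≤ c - 2) :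
      FCSEdge a b c (.q3, 2 * d - 1) (.t3, 2 * d - 1)
  | r3u3 (d : ℕ) (h₁ : 1 ≤ d) (h₂ : d ≤ b - 2) :
      FCSEdge a b c (.r3, 2 * d - 1) (.u3, 2 * d - 1)
  /- the central hexagon of the starphene -/
  | p3r3 : FCSEdge a b c (.p3, 1) (.r3, 1)
  | q3u3 : FCSEdge a b c (.q3, 1) (.u3, 1)
  | s3t3 : FCSEdge a b c (.s3, 1) (.t3, 1)
  /- the edges joining the arms of the starphene to the inner boundary of the coronoid -/
  | p3t2 : FCSEdge a b c (.p3, 2 * a - 5) (.t2, 2 * c - 4)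
  | s3u2 : FCSEdge a b c (.s3, 2 * a - 5) (.u2, 2)
  | q3u1 : FCSEdge a b c (.q3, 2 * c - 5) (.u1, 2 * b - 4)
  | t3s2 : FCSEdge a b c (.t3, 2 * c - 5) (.s2, 2 * a - 4)
  | r3s1 : FCSEdge a b c (.r3, 2 * b - 5) (.s1, 2 * a - 4)
  | u3t1 : FCSEdge a b c (.u3, 2 * b - 5) (.t1, 2)
  /- the six corners of the coronoid, outer and inner boundary -/
  | p1q2 : FCSEdge a b c (.p1, 1) (.q2, 1)
  | s1t2 : FCSEdge a b c (.s1, 1) (.t2, 1)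
  | p1q1 : FCSEdge a b c (.p1, 2 * a - 1) (.q1, 1)
  | s1t1 : FCSEdge a b c (.s1, 2 * a - 3) (.t1, 1)
  | q1r1 : FCSEdge a b c (.q1, 2 * c - 1) (.r1, 1)
  | t1u1 : FCSEdge a b c (.t1, 2 * c - 3) (.u1, 1)
  | r1p2 : FCSEdge a b c (.r1, 2 * b - 1) (.p2, 2 * a - 1)
  | u1s2 : FCSEdge a b c (.u1, 2 * b - 3) (.s2, 2 * a - 3)
  | p2r2 : FCSEdge a b c (.p2, 1) (.r2, 2 * b - 1)
  | s2u2 : FCSEdge a b c (.s2, 1) (.u2, 2 * b - 3)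
  | r2q2 : FCSEdge a b c (.r2, 1) (.q2, 2 * c - 1)
  | u2t2 : FCSEdge a b c (.u2, 1) (.t2, 2 * c - 3)

/-- The zigzag-edge coronoid fused with a starphene, `FCS_{a,b,c}`, for `a, b, c ≥ 4`. -/
def FCS (a b c : ℕ) : SimpleGraph (FCSVertex a b c) :=
  SimpleGraph.fromRel fun v w => FCSEdge a b c v.1 w.1

/-!
All distances in the coronoid can be written down explicitly: if `u` is a vertex whose position is
an affine function of the sizes, then along every family the distance to `u` is a minimum of
functions `d ↦ |d - v| + h`, where the *sites* `(v, h)` are affine in the sizes, too. The list of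
sites comes from Dijkstra's algorithm, run with affine forms instead of numbers (`table`). Forms
are compared coefficientwise, in parameters that range over the natural numbers: `X = a - 4`,
`Y = b - 4`, and a third one for `c - b`, because the reflection `swapIso` allows the assumption
`b ≤ c`. Every site is the length of a walk (`sound_table`); conversely, if the table is closed
under all ways to leave a family, then no walk is shorter (`exists_reaches_of_walk`). Closedness is
a finite check, evaluated by the kernel once for each source.

Lower bound. There are 27 pairs of vertices near the corners and at the ends of the arms such that,
for any two vertices `x` and `y`, one of the pairs is resolved neither by `x` nor by `y`. For every
family a decision tree on the sizes and the position of `x` lists pairs that `x` does not resolve,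
and any two leaves of these trees have a pair in common (`exists_unresolved`).

Upper bound. If `b ≤ c`, then the vertices `t₂` at `c - b + 1`, `t₁` at `c - b + 3` and `p₂` at
`2a - 3` resolve the coronoid. Which positions next to the first two have rungs depends on
the parity of `c - b`, so the two parities are treated separately. Decision trees cut every family into cells
on which the three distances are affine; for any two cells, equality of all three distances
contradicts the inequalities that define the cells (`isMetricGenerator_of_resolving`).

The inequalities between affine forms are established by a small verified prover (`Lin.prove`).
-/

/-! ### Linear forms in the size parameters -/

namespace Coronoid

/-- A choice of the three size parameters `x, y, z`, all natural numbers. -/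
structure Params where
  x : ℕ
  y : ℕ
  z : ℕ

/-- An affine form `c + x X + y Y + z Z` in the size parameters, with natural coefficients. -/
structure Form where
  c : ℕ
  x : ℕ
  y : ℕ
  z : ℕ

namespace Form

def eval (w : Params) (f : Form) : ℕ := f.c + f.x * w.x + f.y * w.y + f.z * w.z

protected def add (f g : Form) : Form :=
  ⟨Nat.add f.c g.c, Nat.add f.x g.x, Nat.add f.y g.y, Nat.add f.z g.z⟩

/-- Truncated coefficientwise difference. -/
protected def sub (f g : Form) : Form :=
  ⟨Nat.sub f.c g.c, Nat.sub f.x g.x, Nat.sub f.y g.y, Nat.sub f.z g.z⟩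

def const (k : ℕ) : Form := ⟨k, 0, 0, 0⟩

/-- The form `f + k`. -/
def addConst (f : Form) (k : ℕ) : Form := ⟨Nat.add f.c k, f.x, f.y, f.z⟩

/-- The form `f - k`, with truncated subtraction in the constant term. -/
def subConst (f : Form) (k : ℕ) : Form := ⟨Nat.sub f.c k, f.x, f.y, f.z⟩

/-- Coefficientwise comparison. -/
def le (f g : Form) : Bool :=
  Nat.ble f.c g.c && (Nat.ble f.x g.x && (Nat.ble f.y g.y && Nat.ble f.z g.z))

/-- Whether `f - g` has a constant sign for coefficientwise reasons. -/
def comparable (f g : Form) : Bool := f.le g || g.le f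

/-- The form `|f - g|`, provided that `f` and `g` are comparable. -/
def absDiff (f g : Form) : Form := bif f.le g then g.sub f else f.sub g

/-- All coefficients are even. -/
def isEven (f : Form) : Bool :=
  Nat.beq (f.c % 2) 0 && (Nat.beq (f.x % 2) 0 &&
    (Nat.beq (f.y % 2) 0 && Nat.beq (f.z % 2) 0))

variable (w : Params) (f g : Form) (k : ℕ)

@[simp] lemma eval_const : (const k).eval w = k := by simp [eval, const]

@[simp] lemma eval_add : (f.add g).eval w = f.eval w + g.eval w := by
  simp only [eval, Form.add, Nat.add_eq]; ring

@[simp] lemma eval_addConst : (f.addConst k).eval w = f.eval w + k := by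
  simp only [eval, addConst, Nat.add_eq]; ring

lemma eval_subConst {f : Form} {k : ℕ} (h : k ≤ f.c) :
    (f.subConst k).eval w = f.eval w - k := by
  simp only [eval, subConst, Nat.sub_eq]; omega

lemma const_le_eval : f.c ≤ f.eval w := by
  simp only [eval]; omega

variable {f g}

lemma le_iff : f.le g = true ↔ f.c ≤ g.c ∧ f.x ≤ g.x ∧ f.y ≤ g.y ∧ f.z ≤ g.z := by
  simp [le]

lemma eval_le_eval (h : f.le g = true) : f.eval w ≤ g.eval w := by
  obtain ⟨h1, h2, h3, h4⟩ := le_iff.1 h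
  simp only [eval]
  gcongr

lemma eval_sub (h : f.le g = true) : (g.sub f).eval w + f.eval w = g.eval w := by
  obtain ⟨h1, h2, h3, h4⟩ := le_iff.1 h
  obtain ⟨k1, e1⟩ := Nat.exists_eq_add_of_le h1
  obtain ⟨k2, e2⟩ := Nat.exists_eq_add_of_le h2
  obtain ⟨k3, e3⟩ := Nat.exists_eq_add_of_le h3
  obtain ⟨k4, e4⟩ := Nat.exists_eq_add_of_le h4
  simp only [eval, Form.sub, Nat.sub_eq, e1, e2, e3, e4, Nat.add_sub_cancel_left]
  ring

lemma eval_absDiff (h : f.comparable g = true) :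
    f.eval w + (absDiff f g).eval w = g.eval w ∨ g.eval w + (absDiff f g).eval w = f.eval w := by
  unfold absDiff
  cases hfg : f.le g
  · have hgf : g.le f = true := by simpa [comparable, hfg] using h
    right
    have := eval_sub w hgf
    simp only [cond_false]
    omega
  · left
    have := eval_sub w hfg
    simp only [cond_true]
    omega

lemma eval_even (h : f.isEven = true) : f.eval w % 2 = 0 := by
  simp only [isEven, Bool.and_eq_true, Nat.beq_eq] at h
  obtain ⟨h1, h2, h3, h4⟩ := h
  have e1 := Nat.dvd_of_mod_eq_zero h1
  have e2 := (Nat.dvd_of_mod_eq_zero h2).mul_right w.x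
  have e3 := (Nat.dvd_of_mod_eq_zero h3).mul_right w.y
  have e4 := (Nat.dvd_of_mod_eq_zero h4).mul_right w.z
  simp only [eval]
  omega

end Form

/-! ### A prover for linear inequalities -/

/-- An affine form `c + x X + y Y + z Z + d D + e E` with integer coefficients in the size
parameters and two further variables `D`, `E`, the positions of two vertices on their lines. All
variables are natural numbers. -/
structure Lin where
  c : ℤ
  x : ℤ
  y : ℤ
  z : ℤ
  d : ℤ
  e : ℤ

/-- Whether an integer is negative, by its constructor, which is cheap for the kernel. -/
def isNeg : ℤ → Bool
  | .ofNat _ => false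
  | .negSucc _ => true

lemma isNeg_iff {n : ℤ} : isNeg n = true ↔ n < 0 := by
  cases n <;> simp [isNeg, Int.negSucc_lt_zero]

namespace Lin

def eval (w : Params) (d e : ℕ) (f : Lin) : ℤ :=
  f.c + f.x * w.x + f.y * w.y + f.z * w.z + f.d * d + f.e * e

protected def add (f g : Lin) : Lin :=
  ⟨f.c + g.c, f.x + g.x, f.y + g.y, f.z + g.z, f.d + g.d, f.e + g.e⟩

protected def sub (f g : Lin) : Lin :=
  ⟨f.c - g.c, f.x - g.x, f.y - g.y, f.z - g.z, f.d - g.d, f.e - g.e⟩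

/-- The combination `a f - b g`. -/
def comb (a : ℤ) (f : Lin) (b : ℤ) (g : Lin) : Lin :=
  ⟨a * f.c - b * g.c, a * f.x - b * g.x, a * f.y - b * g.y, a * f.z - b * g.z,
    a * f.d - b * g.d, a * f.e - b * g.e⟩

/-- The negation `-f - 1` of the inequality `0 ≤ f` over the integers. -/
def compl (f : Lin) : Lin := ⟨-f.c - 1, -f.x, -f.y, -f.z, -f.d, -f.e⟩

def ofForm (f : Form) : Lin := ⟨f.c, f.x, f.y, f.z, 0, 0⟩

/-- The form read off at the second position instead of the first. -/
def second (f : Lin) : Lin := ⟨f.c, f.x, f.y, f.z, 0, f.d⟩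

/-- The form with its coefficient at the second position removed. -/
def first (f : Lin) : Lin := ⟨f.c, f.x, f.y, f.z, f.d, 0⟩

/-- The first negative coefficient, as a projection. -/
def pivot (f : Lin) : Option (Lin → ℤ) :=
  bif isNeg f.c then some c else bif isNeg f.x then some x else bif isNeg f.y then some y
  else bif isNeg f.z then some z else bif isNeg f.d then some d
  else bif isNeg f.e then some e else none

/-- A search for a proof of `0 ≤ f` from `0 ≤ g`, `g ∈ G`: a form with natural coefficients is
nonnegative, and a negative coefficient can be cancelled against the same coefficient of a
hypothesis. Against a negative constant term a hypothesis is also subtracted just once, which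
leaves a part of the constant for other hypotheses. The number bounds the depth of the search. -/
def prove (G : List Lin) : ℕ → Lin → Bool
  | 0, f => f.pivot.isNone
  | n + 1, f =>
    match f.pivot with
    | none => true
    | some j => G.any fun g => isNeg (j g) &&
        (prove G n (comb (j g).natAbs f (j f).natAbs g) || (isNeg f.c && prove G n (f.sub g)))

variable (w : Params) (i j : ℕ) (f g : Lin)

@[simp] lemma eval_add : (f.add g).eval w i j = f.eval w i j + g.eval w i j := by
  simp only [eval, Lin.add]; ring

@[simp] lemma eval_sub : (f.sub g).eval w i j = f.eval w i j - g.eval w i j := by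
  simp only [eval, Lin.sub]; ring

@[simp] lemma eval_comb (a b : ℤ) :
    (comb a f b g).eval w i j = a * f.eval w i j - b * g.eval w i j := by
  simp only [eval, comb]; ring

@[simp] lemma eval_compl : f.compl.eval w i j = -f.eval w i j - 1 := by
  simp only [eval, compl]; ring

@[simp] lemma eval_ofForm (f : Form) : (ofForm f).eval w i j = f.eval w := by
  simp only [eval, ofForm, Form.eval]; push_cast; ring

@[simp] lemma eval_first : f.first.eval w i j = f.eval w i 0 := by
  simp [eval, first]

@[simp] lemma eval_second : f.second.eval w i j = f.eval w j 0 := by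
  simp [eval, second]

variable {f}

lemma eval_nonneg_of_pivot (h : f.pivot = none) : 0 ≤ f.eval w i j := by
  have key : isNeg f.c = false ∧ isNeg f.x = false ∧ isNeg f.y = false ∧ isNeg f.z = false ∧
      isNeg f.d = false ∧ isNeg f.e = false := by
    revert h
    unfold pivot
    cases isNeg f.c <;> cases isNeg f.x <;> cases isNeg f.y <;> cases isNeg f.z <;>
      cases isNeg f.d <;> cases isNeg f.e <;> simp
  have conv : ∀ n : ℤ, isNeg n = false → 0 ≤ n := fun n hn => by
    by_contra hlt
    rw [isNeg_iff.2 (not_le.1 hlt)] at hn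
    exact absurd hn (by decide)
  obtain ⟨h1, h2, h3, h4, h5, h6⟩ := key
  have := conv _ h1; have := conv _ h2; have := conv _ h3
  have := conv _ h4; have := conv _ h5; have := conv _ h6
  unfold eval
  positivity

lemma eval_nonneg_of_prove {G : List Lin} (hG : ∀ g ∈ G, 0 ≤ g.eval w i j) :
    ∀ {n : ℕ} {f : Lin}, prove G n f = true → 0 ≤ f.eval w i j
  | 0, f, h => eval_nonneg_of_pivot w i j (by simpa [prove] using h)
  | n + 1, f, h => by
    rw [prove] at h
    split at h
    · exact eval_nonneg_of_pivot w i j ‹_›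
    · rename_i p _
      obtain ⟨g, hg, h⟩ := List.any_eq_true.1 h
      simp only [Bool.and_eq_true, Bool.or_eq_true] at h
      obtain ⟨hneg, h | ⟨-, h⟩⟩ := h
      · have ih := eval_nonneg_of_prove hG h
        rw [eval_comb] at ih
        have hpos : (0 : ℤ) < ((p g).natAbs : ℤ) := by
          have := isNeg_iff.1 hneg
          omega
        have h2 : 0 ≤ (((p f).natAbs : ℕ) : ℤ) * g.eval w i j :=
          mul_nonneg (Int.natCast_nonneg _) (hG g hg)
        have h3 : 0 ≤ ((p g).natAbs : ℤ) * f.eval w i j := by linarith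
        exact nonneg_of_mul_nonneg_right h3 hpos
      · have ih := eval_nonneg_of_prove hG h
        rw [eval_sub] at ih
        have := hG g hg
        linarith

end Lin

/-- A binary decision tree: at an inner node the sign of a linear form decides between the first
branch (`0 ≤ f`) and the second branch (`0 ≤ -f - 1`). -/
inductive Tree (α : Type) : Type
  | leaf (a : α) : Tree α
  | split (f : Lin) (s t : Tree α) : Tree α

namespace Tree

variable {α : Type}

/-- The leaves of a tree, each with the inequalities that lead to it, which are added to `G`. -/
def leaves : Tree α → List Lin → List (List Lin × α)
  | leaf a, G => [(G, a)]
  | split f s t, G => s.leaves (f :: G) ++ t.leaves (f.compl :: G)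

lemma exists_leaf (w : Params) (i j : ℕ) : ∀ (t : Tree α) (G : List Lin),
    (∀ g ∈ G, 0 ≤ g.eval w i j) → ∃ l ∈ t.leaves G, ∀ g ∈ l.1, 0 ≤ g.eval w i j
  | leaf a, G, h => ⟨(G, a), by simp [leaves], h⟩
  | split f s t, G, h => by
    rcases le_or_gt 0 (f.eval w i j) with hf | hf
    · obtain ⟨l, hl, h'⟩ := exists_leaf w i j s (f :: G) (by simpa using ⟨hf, h⟩)
      exact ⟨l, by simp [leaves, hl], h'⟩
    · obtain ⟨l, hl, h'⟩ := exists_leaf w i j t (f.compl :: G)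
        (by simpa using ⟨by linarith [Int.add_one_le_iff.2 hf], h⟩)
      exact ⟨l, by simp [leaves, hl], h'⟩

end Tree

end Coronoid

/-! ### The coronoid in symbolic form -/

namespace FCSLine

/-- A numbering of the families. -/
def idx : FCSLine → ℕ
  | p1 => 0 | p2 => 1 | p3 => 2 | q1 => 3 | q2 => 4 | q3 => 5 | r1 => 6 | r2 => 7 | r3 => 8
  | s1 => 9 | s2 => 10 | s3 => 11 | t1 => 12 | t2 => 13 | t3 => 14 | u1 => 15 | u2 => 16 | u3 => 17

lemma idx_injective : Function.Injective idx := by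
  intro L M h
  cases L <;> cases M <;> first | rfl | exact absurd h (by decide)

instance : DecidableEq FCSLine := fun L M =>
  decidable_of_iff (L.idx = M.idx) idx_injective.eq_iff

def all : List FCSLine :=
  [p1, p2, p3, q1, q2, q3, r1, r2, r3, s1, s2, s3, t1, t2, t3, u1, u2, u3]

lemma mem_all (L : FCSLine) : L ∈ all := by cases L <;> simp [all]

/-- `L.elim f` is `f L`; its evaluation reduces `L` to a constructor before `f` sees it. -/
def elim {α : Type} (f : FCSLine → α) : FCSLine → α
  | p1 => f p1 | p2 => f p2 | p3 => f p3 | q1 => f q1 | q2 => f q2 | q3 => f q3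
  | r1 => f r1 | r2 => f r2 | r3 => f r3 | s1 => f s1 | s2 => f s2 | s3 => f s3
  | t1 => f t1 | t2 => f t2 | t3 => f t3 | u1 => f u1 | u2 => f u2 | u3 => f u3

@[simp] lemma elim_eq {α : Type} (f : FCSLine → α) (L : FCSLine) : L.elim f = f L := by
  cases L <;> rfl

/-- The family that is joined to the given one by rungs, the edges `p1s1` to `r3u3` of
`FCSEdge`. -/
def mate : FCSLine → FCSLine
  | p1 => s1 | p2 => s2 | p3 => s3 | q1 => t1 | q2 => t2 | q3 => t3
  | r1 => u1 | r2 => u2 | r3 => u3 | s1 => p1 | s2 => p2 | s3 => p3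
  | t1 => q1 | t2 => q2 | t3 => q3 | u1 => r1 | u2 => r2 | u3 => r3

/-- Whether the family lies on the outer boundary of the coronoid. There the rungs are at the even
positions, on the other families at the odd ones. -/
def outer : FCSLine → Bool
  | p1 | p2 | q1 | q2 | r1 | r2 => true
  | _ => false

/-- Whether a rung ends at position `d` of the family. -/
def IsRung (L : FCSLine) (d : ℕ) : Prop := d % 2 = bif L.outer then 0 else 1

/-- The position on `L.mate` of the other end of the rung at position `d` of `L`. -/
def across (L : FCSLine) (d : ℕ) : ℕ :=
  match L with
  | p1 | p2 | q1 | q2 | r1 | r2 => d - 1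
  | s1 | s2 | t1 | t2 | u1 | u2 => d + 1
  | _ => d

end FCSLine

namespace Coronoid

open FCSLine Form

/-- The position `2n - k` on a family, where `n` is the one of `a = 4 + X`, `b = 4 + Y` and `c`
that governs the length of the family. The third size `c` is an arbitrary form `C`. Truncation does
not matter for `k ≤ 8` and `4 ≤ C.c`. -/
def pos (C : Form) (k : ℕ) : FCSLine → Form
  | p1 | p2 | p3 | s1 | s2 | s3 => ⟨8 - k, 2, 0, 0⟩
  | r1 | r2 | r3 | u1 | u2 | u3 => ⟨8 - k, 0, 2, 0⟩
  | _ => (C.add C).subConst k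

/-- The difference between twice the governing size and the length of a family. -/
def defect : FCSLine → ℕ
  | p1 | p2 | q1 | q2 | r1 | r2 => 1
  | s1 | s2 | t1 | t2 | u1 | u2 => 3
  | _ => 5

/-- The number of vertices of a family, as a form. -/
def length (C : Form) (L : FCSLine) : Form := pos C (defect L) L

/-- The edges from `p3r3` to `u2t2` of `FCSEdge` that start at a given family: the position on that
family, the family of the other end and the position there. -/
def exits (C : Form) : FCSLine → List (Form × FCSLine × Form)
  | p1 => [(const 1, q2, const 1), (length C p1, q1, const 1)]
  | q2 => [(const 1, p1, const 1), (length C q2, r2, const 1)]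
  | q1 => [(const 1, p1, length C p1), (length C q1, r1, const 1)]
  | r1 => [(const 1, q1, length C q1), (length C r1, p2, length C p2)]
  | p2 => [(const 1, r2, length C r2), (length C p2, r1, length C r1)]
  | r2 => [(const 1, q2, length C q2), (length C r2, p2, const 1)]
  | s1 => [(const 1, t2, const 1), (length C s1, t1, const 1), (pos C 4 s1, r3, length C r3)]
  | t2 => [(const 1, s1, const 1), (length C t2, u2, const 1), (pos C 4 t2, p3, length C p3)]
  | t1 => [(const 1, s1, length C s1), (length C t1, u1, const 1), (const 2, u3, length C u3)]
  | u1 => [(const 1, t1, length C t1), (length C u1, s2, length C s2),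
      (pos C 4 u1, q3, length C q3)]
  | s2 => [(const 1, u2, length C u2), (length C s2, u1, length C u1),
      (pos C 4 s2, t3, length C t3)]
  | u2 => [(const 1, t2, length C t2), (length C u2, s2, const 1), (const 2, s3, length C s3)]
  | p3 => [(const 1, r3, const 1), (length C p3, t2, pos C 4 t2)]
  | r3 => [(const 1, p3, const 1), (length C r3, s1, pos C 4 s1)]
  | q3 => [(const 1, u3, const 1), (length C q3, u1, pos C 4 u1)]
  | u3 => [(const 1, q3, const 1), (length C u3, t1, const 2)]
  | s3 => [(const 1, t3, const 1), (length C s3, u2, const 2)]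
  | t3 => [(const 1, s3, const 1), (length C t3, s2, pos C 4 s2)]

/-- The coronoid with the sizes `4 + X`, `4 + Y` and `C`. -/
abbrev graph (C : Form) (w : Params) := FCS (4 + w.x) (4 + w.y) (C.eval w)

/-- The number of vertices of a family. -/
abbrev len (C : Form) (w : Params) (L : FCSLine) : ℕ := L.len (4 + w.x) (4 + w.y) (C.eval w)

/-- The vertex at position `d` of the family `L`. -/
def vert {C : Form} {w : Params} (L : FCSLine) (d : ℕ) (h : 1 ≤ d ∧ d ≤ len C w L) :
    FCSVertex (4 + w.x) (4 + w.y) (C.eval w) :=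
  ⟨(L, d), h⟩

variable {C : Form} {w : Params}

lemma four_le (hC : 4 ≤ C.c) : 4 ≤ C.eval w := hC.trans (const_le_eval w C)

lemma eval_length (hC : 4 ≤ C.c) (L : FCSLine) : (length C L).eval w = len C w L := by
  have h : ∀ k ≤ 5, ((C.add C).subConst k).eval w = 2 * C.eval w - k := fun k hk => by
    rw [eval_subConst _ (by simp only [Form.add, Nat.add_eq]; omega), eval_add]; omega
  cases L <;> simp only [length, pos, defect, len, FCSLine.len, h, Nat.reduceLeDiff] <;>
    simp only [eval] <;> omega

lemma eval_pos_four (hC : 4 ≤ C.c) :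
    (pos C 4 s1).eval w = 2 * (4 + w.x) - 4 ∧ (pos C 4 s2).eval w = 2 * (4 + w.x) - 4 ∧
      (pos C 4 t2).eval w = 2 * C.eval w - 4 ∧ (pos C 4 u1).eval w = 2 * (4 + w.y) - 4 := by
  have h : ((C.add C).subConst 4).eval w = 2 * C.eval w - 4 := by
    rw [eval_subConst _ (by simp only [Form.add, Nat.add_eq]; omega), eval_add]; omega
  refine ⟨?_, ?_, h, ?_⟩ <;> simp only [pos, eval] <;> omega

lemma exists_edge_of_adj {v v' : FCSVertex (4 + w.x) (4 + w.y) (C.eval w)}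
    (h : (graph C w).Adj v v') :
    FCSEdge (4 + w.x) (4 + w.y) (C.eval w) v.1 v'.1 ∨
      FCSEdge (4 + w.x) (4 + w.y) (C.eval w) v'.1 v.1 := by
  simpa [FCS, SimpleGraph.fromRel_adj, and_comm] using h.2

/-- Two adjacent vertices are joined by an edge within a family, by an edge listed in `exits`, or by
a rung. -/
lemma adj_cases (hC : 4 ≤ C.c) {L M : FCSLine} {d d' : ℕ}
    (h : FCSEdge (4 + w.x) (4 + w.y) (C.eval w) (L, d) (M, d') ∨
      FCSEdge (4 + w.x) (4 + w.y) (C.eval w) (M, d') (L, d)) :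
    (M = L ∧ (d' = d + 1 ∨ d = d' + 1)) ∨
      (∃ e ∈ exits C L, e.1.eval w = d ∧ e.2.1 = M ∧ e.2.2.eval w = d') ∨
      (L.IsRung d ∧ M = L.mate ∧ d' = L.across d) := by
  have hc := four_le (w := w) hC
  obtain ⟨e1, e2, e3, e4⟩ := eval_pos_four (w := w) hC
  rcases h with h | h <;> cases h
  all_goals first
    | (left; refine ⟨rfl, ?_⟩; omega)
    | (right; right; refine ⟨?_, rfl, ?_⟩ <;>
        simp only [IsRung, outer, across, cond_true, cond_false] <;> omega)
    | (right; left
       simp [exits, eval_length hC, len, FCSLine.len, e1, e2, e3, e4])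

lemma edge_of_rung {a b c : ℕ} {L : FCSLine} {d : ℕ} (h1 : 1 ≤ d) (h2 : d ≤ L.len a b c)
    (h : L.IsRung d) :
    FCSEdge a b c (L, d) (L.mate, L.across d) ∨ FCSEdge a b c (L.mate, L.across d) (L, d) := by
  have even : d % 2 = 0 → ∃ k, d = 2 * k := fun h => ⟨d / 2, by omega⟩
  have odd : d % 2 = 1 → ∃ k, d = 2 * k - 1 ∧ d + 1 = 2 * k := fun h => ⟨(d + 1) / 2, by omega⟩
  cases L <;> simp only [IsRung, outer, cond_true, cond_false] at h <;>
    simp only [FCSLine.len] at h2 <;> simp only [mate, across]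
  all_goals first
    | (obtain ⟨k, rfl⟩ := even h; left; constructor <;> omega)
    | (obtain ⟨k, hk, hk'⟩ := odd h; rw [hk']; subst hk; right; constructor <;> omega)
    | (obtain ⟨k, rfl, -⟩ := odd h; left; constructor <;> omega)
    | (obtain ⟨k, rfl, -⟩ := odd h; right; constructor <;> omega)

lemma across_mem {a b c : ℕ} {L : FCSLine} {d : ℕ} (h1 : 1 ≤ d) (h2 : d ≤ L.len a b c)
    (h : L.IsRung d) : 1 ≤ L.across d ∧ L.across d ≤ L.mate.len a b c := by
  cases L <;> simp only [IsRung, outer, across, cond_true, cond_false, mate, FCSLine.len] at * <;>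
    omega

lemma edge_of_exit (hC : 4 ≤ C.c) {L : FCSLine} {e : Form × FCSLine × Form} (he : e ∈ exits C L) :
    FCSEdge (4 + w.x) (4 + w.y) (C.eval w) (L, e.1.eval w) (e.2.1, e.2.2.eval w) ∨
      FCSEdge (4 + w.x) (4 + w.y) (C.eval w) (e.2.1, e.2.2.eval w) (L, e.1.eval w) := by
  obtain ⟨e1, e2, e3, e4⟩ := eval_pos_four (w := w) hC
  cases L <;> simp only [exits, List.mem_cons, List.not_mem_nil, or_false] at he <;>
    rcases he with rfl | rfl | rfl <;>
    simp only [eval_length hC, len, FCSLine.len, eval_const, e1, e2, e3, e4] <;>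
    first | (left; constructor) | (right; constructor)

lemma exit_mem (hC : 4 ≤ C.c) {L : FCSLine} {e : Form × FCSLine × Form} (he : e ∈ exits C L) :
    (1 ≤ e.1.eval w ∧ e.1.eval w ≤ len C w L) ∧
      1 ≤ e.2.2.eval w ∧ e.2.2.eval w ≤ len C w e.2.1 := by
  have hc := four_le (w := w) hC
  obtain ⟨e1, e2, e3, e4⟩ := eval_pos_four (w := w) hC
  cases L <;> simp only [exits, List.mem_cons, List.not_mem_nil, or_false] at he <;>
    rcases he with rfl | rfl | rfl <;>
    simp only [eval_length hC, len, FCSLine.len, eval_const, e1, e2, e3, e4] <;> omega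

end Coronoid

/-! ### Distance tables -/

namespace Coronoid

open FCSLine Form

/-- A site on a family stands for the distance function `d ↦ |d - v| + h` along that family. -/
structure Site where
  v : Form
  h : Form

/-- A table lists sites on every family. It describes the distance to a source if that distance is
the minimum of the functions of the sites, on every family. -/
abbrev Table := FCSLine → List Site

/-- `s.reaches w d n` says that `|d - v| + h ≤ n` for the site `s = (v, h)`. -/
def Site.reaches (s : Site) (w : Params) (d n : ℕ) : Prop :=
  d + s.h.eval w ≤ n + s.v.eval w ∧ s.v.eval w + s.h.eval w ≤ n + d

/-- A coefficientwise sufficient condition for the value of `s` at `v` to be at most `h`. -/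
def Site.covers (s : Site) (v h : Form) : Bool :=
  (v.add s.h).le (h.add s.v) && (s.v.add s.h).le (h.add v)

/-- Whether one of the sites has at `v` a value of at most `h`. -/
def covered (l : List Site) (v h : Form) : Bool := l.any fun s => s.covers v h

lemma Site.reaches_of_covers {s : Site} {v h : Form} (hs : s.covers v h = true) (w : Params) :
    s.reaches w (v.eval w) (h.eval w) := by
  simp only [covers, Bool.and_eq_true] at hs
  have h1 := eval_le_eval w hs.1
  have h2 := eval_le_eval w hs.2
  simp only [eval_add] at h1 h2
  exact ⟨h1, h2⟩

lemma exists_of_covered {l : List Site} {v h : Form} (H : covered l v h = true) (w : Params) :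
    ∃ s ∈ l, s.reaches w (v.eval w) (h.eval w) := by
  obtain ⟨s, hs, h⟩ := List.any_eq_true.1 H
  exact ⟨s, hs, Site.reaches_of_covers h w⟩

/-- Whether `v` is a position on the family, for all values of the parameters. -/
def inRange (C : Form) (L : FCSLine) (v : Form) : Bool := (const 1).le v && v.le (length C L)

/-- Whether the position `v` is one of a rung, for all values of the parameters. -/
def onRung (L : FCSLine) (v : Form) : Bool := (bif L.outer then v else v.addConst 1).isEven

/-- The position at the other end of the rung at `v`. -/
def acrossForm (L : FCSLine) (v : Form) : Form :=
  match L with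
  | p1 | p2 | q1 | q2 | r1 | r2 => v.subConst 1
  | s1 | s2 | t1 | t2 | u1 | u2 => v.addConst 1
  | _ => v

/-- The rungs nearest to the position `v`, each with the length of the path over it from `v` to the
other family. -/
def rungsNear (C : Form) (L : FCSLine) (v : Form) : List (Form × ℕ) :=
  (bif onRung L v then [(v, 1)]
    else bif onRung L (v.addConst 1) then [(v.subConst 1, 2), (v.addConst 1, 2)]
    else []).filter fun p => inRange C L p.1

/-- The sites on other families that a site gives rise to. -/
def successors (C : Form) (L : FCSLine) (s : Site) : List (FCSLine × Site) :=
  (((exits C L).filter fun e => s.v.comparable e.1).map fun e =>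
    (e.2.1, ⟨e.2.2, s.h.add ((s.v.absDiff e.1).addConst 1)⟩)) ++
  (rungsNear C L s.v).map fun p => (L.mate, ⟨acrossForm L p.1, s.h.addConst p.2⟩)

/-- Adds a site, and removes those that it makes superfluous. -/
def addSite (T : Table) (L : FCSLine) (s : Site) : Table := elim fun M =>
  bif Nat.beq M.idx L.idx then s :: (T M).filter fun t => !(s.covers t.v t.h) else T M

/-- An estimate of the size of a form, which decides the order in which `saturate` treats the sites.
The factor `16` makes the parameters large in comparison with the constants. -/
def weight (f : Form) : ℕ := Nat.add f.c (Nat.mul 16 (Nat.add f.x (Nat.add f.y f.z)))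

/-- Insertion into a list that is ordered by weight. -/
def push (p : FCSLine × Site) : List (FCSLine × Site) → List (FCSLine × Site)
  | [] => [p]
  | q :: l => bif Nat.ble (weight p.2.h) (weight q.2.h) then p :: q :: l else q :: push p l

/-- A symbolic version of Dijkstra's algorithm: it closes a table under `successors`, starting
from a list of sites still to be treated. The number bounds the steps. -/
def saturate (C : Form) : ℕ → Table → List (FCSLine × Site) → Table
  | 0, T, _ => T
  | _ + 1, T, [] => T
  | n + 1, T, p :: l =>
    bif covered (p.1.elim T) p.2.v p.2.h then saturate C n T l
    else p.1.elim fun L => saturate C n (addSite T L p.2) ((successors C L p.2).foldr push l)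

/-- The distance table of the vertex at position `v` of the family `L`. If `400` steps were too few,
the table would still be `Sound`, but not `closed`. -/
def table (C : Form) (L : FCSLine) (v : Form) : Table :=
  saturate C 400 (fun _ => []) [(L, ⟨v, const 0⟩)]

/-- Whether every path that leaves the family from the site `s` is accounted for in the table. -/
def closedAt (C : Form) (T : Table) (L : FCSLine) (s : Site) : Bool :=
  (inRange C L s.v && (exits C L).all fun e => s.v.comparable e.1) &&
  (onRung L s.v ||
    (onRung L (s.v.addConst 1) && (inRange C L (s.v.subConst 1) || s.v.le (const 1)) &&
      (inRange C L (s.v.addConst 1) || (length C L).le s.v))) &&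
  (successors C L s).all fun p => covered (p.1.elim T) p.2.v p.2.h

/-- Whether a table accounts for every path from the vertex at position `v` of the family `L`. -/
def closed (C : Form) (T : Table) (L : FCSLine) (v : Form) : Bool :=
  inRange C L v && covered (T L) v (const 0) &&
    FCSLine.all.all fun M => !(T M).isEmpty && (T M).all fun s => closedAt C T M s

variable {C : Form} {w : Params} {u : FCSVertex (4 + w.x) (4 + w.y) (C.eval w)}

lemma mem_range_of_inRange (hC : 4 ≤ C.c) {L : FCSLine} {v : Form} (h : inRange C L v = true) :
    1 ≤ v.eval w ∧ v.eval w ≤ len C w L := by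
  simp only [inRange, Bool.and_eq_true] at h
  have h1 := eval_le_eval w h.1
  have h2 := eval_le_eval w h.2
  rw [eval_const] at h1
  rw [eval_length hC] at h2
  exact ⟨h1, h2⟩

lemma one_le_of_inRange {L : FCSLine} {v : Form} (h : inRange C L v = true) : 1 ≤ v.c := by
  simp only [inRange, Bool.and_eq_true] at h
  exact (le_iff.1 h.1).1

lemma isRung_of_onRung {L : FCSLine} {v : Form} (h : onRung L v = true) (w : Params) :
    L.IsRung (v.eval w) := by
  unfold onRung at h
  unfold IsRung
  cases hL : L.outer <;> rw [hL] at h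
  · have := eval_even w h
    rw [cond_false, eval_addConst] at this
    rw [cond_false]
    omega
  · exact eval_even w h

lemma isRung_add_one_iff {L : FCSLine} {d : ℕ} : L.IsRung (d + 1) ↔ ¬ L.IsRung d := by
  unfold IsRung
  cases L.outer <;> simp only [cond_true, cond_false] <;> omega

lemma eval_acrossForm {L : FCSLine} {v : Form} (h : 1 ≤ v.c) :
    (acrossForm L v).eval w = L.across (v.eval w) := by
  cases L <;> simp only [acrossForm, across, eval_addConst, eval_subConst w h]

lemma ne_of_edge {a b c : ℕ} {v v' : FCSLine × ℕ} (h : FCSEdge a b c v v') : v ≠ v' := by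
  cases h <;> simp

/-- There is a walk of length at most `n` from `u` to the vertex at position `d` of `L`. -/
def Within (u : FCSVertex (4 + w.x) (4 + w.y) (C.eval w)) (L : FCSLine) (d n : ℕ) : Prop :=
  ∃ h : 1 ≤ d ∧ d ≤ len C w L, ∃ p : (graph C w).Walk u (vert L d h), p.length ≤ n

namespace Within

variable {L M : FCSLine} {d d' m n : ℕ}

lemma mono (H : Within u L d m) (h : m ≤ n) : Within u L d n :=
  let ⟨h', p, hp⟩ := H
  ⟨h', p, hp.trans h⟩

lemma step (H : Within u L d n) (h' : 1 ≤ d' ∧ d' ≤ len C w M)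
    (he : FCSEdge (4 + w.x) (4 + w.y) (C.eval w) (L, d) (M, d') ∨
      FCSEdge (4 + w.x) (4 + w.y) (C.eval w) (M, d') (L, d)) :
    Within u M d' (n + 1) := by
  obtain ⟨h, p, hp⟩ := H
  have hne : (L, d) ≠ (M, d') := he.elim ne_of_edge fun h => (ne_of_edge h).symm
  have hadj : (graph C w).Adj (vert L d h) (vert M d' h') :=
    (SimpleGraph.fromRel_adj ..).2 ⟨fun hh => hne (congrArg Subtype.val hh), he⟩
  exact ⟨h', p.concat hadj, by rw [SimpleGraph.Walk.length_concat]; omega⟩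

lemma along (H : Within u L d n) : ∀ {k d' : ℕ}, 1 ≤ d' → d' ≤ len C w L → d ≤ d' + k →
    d' ≤ d + k → Within u L d' (n + k)
  | 0, d', h1, h2, h3, h4 => by
    obtain rfl : d = d' := by omega
    exact H
  | k + 1, d', h1, h2, h3, h4 => by
    have hd : 1 ≤ d ∧ d ≤ len C w L := H.choose
    rcases lt_trichotomy d d' with h | rfl | h
    · obtain ⟨d', rfl⟩ : ∃ e, d' = e + 1 := ⟨d' - 1, by omega⟩
      exact (along H (k := k) (d' := d') (by omega) (by omega) (by omega) (by omega)).step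
        ⟨h1, h2⟩ (.inl (.path _ _ (by omega) h2))
    · exact H.mono (by omega)
    · exact (along H (k := k) (d' := d' + 1) (by omega) (by omega) (by omega) (by omega)).step
        ⟨h1, h2⟩ (.inr (.path _ _ h1 (by omega : d' + 1 ≤ len C w L)))

/-- Crossing a rung at distance at most `k`. -/
lemma cross (H : Within u L d n) {k e : ℕ} (h1 : 1 ≤ e) (h2 : e ≤ len C w L) (h3 : d ≤ e + k)
    (h4 : e ≤ d + k) (he : L.IsRung e) : Within u L.mate (L.across e) (n + (k + 1)) :=
  (H.along h1 h2 h3 h4).step (across_mem h1 h2 he) (edge_of_rung h1 h2 he)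

end Within

lemma within_of_mem_successors (hC : 4 ≤ C.c) {L : FCSLine} {s : Site}
    (hs : Within u L (s.v.eval w) (s.h.eval w)) {p : FCSLine × Site}
    (hp : p ∈ successors C L s) : Within u p.1 (p.2.v.eval w) (p.2.h.eval w) := by
  simp only [successors, List.mem_append, List.mem_map, List.mem_filter] at hp
  rcases hp with ⟨e, ⟨he, hc⟩, rfl⟩ | ⟨⟨v, k⟩, hv, rfl⟩
  · have hd := eval_absDiff w hc
    have hr := edge_of_exit (w := w) hC he
    obtain ⟨hm, hm'⟩ := exit_mem (w := w) hC he
    simp only [eval_add, eval_addConst]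
    exact ((hs.along (k := (s.v.absDiff e.1).eval w) hm.1 hm.2 (by omega) (by omega)).step hm'
      hr).mono (by omega)
  · simp only [rungsNear, List.mem_filter] at hv
    obtain ⟨hv, hr⟩ := hv
    have hm := mem_range_of_inRange (w := w) hC hr
    have h1 := one_le_of_inRange hr
    simp only [eval_addConst, eval_acrossForm h1]
    cases ho : onRung L s.v
    · rw [ho, cond_false] at hv
      cases ho' : onRung L (s.v.addConst 1)
      · simp [ho'] at hv
      · have hI := isRung_of_onRung ho' w
        rw [eval_addConst] at hI
        simp only [ho', cond_true, List.mem_cons, Prod.mk.injEq, List.not_mem_nil, or_false] at hv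
        obtain ⟨rfl, rfl⟩ | ⟨rfl, rfl⟩ := hv
        · have hc : 1 ≤ s.v.c := by
            simp only [subConst, Nat.sub_eq] at h1; omega
          rw [eval_subConst w hc] at hm ⊢
          have hI' : L.IsRung (s.v.eval w - 1) := by
            have h2 : s.v.eval w - 1 + 1 = s.v.eval w := by omega
            by_contra hn
            rw [← isRung_add_one_iff, h2] at hn
            exact isRung_add_one_iff.1 hI hn
          exact hs.cross (k := 1) hm.1 hm.2 (by omega) (by omega) hI'
        · rw [eval_addConst] at hm ⊢
          exact hs.cross (k := 1) hm.1 hm.2 (by omega) (by omega) hI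
    · simp only [ho, cond_true, List.mem_cons, Prod.mk.injEq, List.not_mem_nil, or_false] at hv
      obtain ⟨rfl, rfl⟩ := hv
      exact hs.cross (k := 0) hm.1 hm.2 (by omega) (by omega) (isRung_of_onRung ho w)

/-- Every site of the table is the length of an actual walk. -/
def Sound (u : FCSVertex (4 + w.x) (4 + w.y) (C.eval w)) (T : Table) : Prop :=
  ∀ L, ∀ s ∈ T L, Within u L (s.v.eval w) (s.h.eval w)

lemma mem_push {p q : FCSLine × Site} : ∀ {l : List (FCSLine × Site)},
    q ∈ push p l → q = p ∨ q ∈ l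
  | [], h => by simpa [push] using h
  | r :: l, h => by
    rw [push] at h
    cases hb : Nat.ble (weight p.2.h) (weight r.2.h) <;> rw [hb] at h
    · rcases List.mem_cons.1 h with rfl | h
      · simp
      · rcases mem_push h with h | h <;> simp [h]
    · exact List.mem_cons.1 h

lemma mem_foldr_push {q : FCSLine × Site} {l : List (FCSLine × Site)} :
    ∀ {k : List (FCSLine × Site)}, q ∈ k.foldr push l → q ∈ k ∨ q ∈ l
  | [], h => .inr h
  | p :: k, h => by
    rcases mem_push h with rfl | h
    · simp
    · rcases mem_foldr_push h with h | h <;> simp [h]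

lemma Sound.saturate (hC : 4 ≤ C.c) : ∀ {n : ℕ} {T : Table} {l : List (FCSLine × Site)},
    Sound u T → (∀ p ∈ l, Within u p.1 (p.2.v.eval w) (p.2.h.eval w)) →
      Sound u (saturate C n T l)
  | 0, _, _, hT, _ => hT
  | _ + 1, _, [], hT, _ => hT
  | n + 1, T, p :: l, hT, hl => by
    rw [Coronoid.saturate]
    have hp := hl p (by simp)
    have hl' : ∀ q ∈ l, Within u q.1 (q.2.v.eval w) (q.2.h.eval w) := fun q hq =>
      hl q (by simp [hq])
    cases covered (p.1.elim T) p.2.v p.2.h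
    · rw [cond_false, elim_eq]
      refine Sound.saturate hC (fun M s hs => ?_) fun q hq => ?_
      · rw [addSite, elim_eq] at hs
        cases hM : Nat.beq M.idx p.1.idx <;> rw [hM] at hs
        · exact hT M s hs
        · obtain rfl : M = p.1 := idx_injective (Nat.eq_of_beq_eq_true hM)
          rcases List.mem_cons.1 hs with rfl | hs
          · exact hp
          · exact hT _ s (List.mem_filter.1 hs).1
      · rcases mem_foldr_push hq with hq | hq
        · exact within_of_mem_successors hC hp hq
        · exact hl' q hq
    · exact Sound.saturate hC hT hl'

/-- The vertex at position `v` of the family `L`. -/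
def vertAt (hC : 4 ≤ C.c) {L : FCSLine} {v : Form} (h : inRange C L v = true) :
    FCSVertex (4 + w.x) (4 + w.y) (C.eval w) :=
  vert L (v.eval w) (mem_range_of_inRange hC h)

lemma sound_table (hC : 4 ≤ C.c) {L : FCSLine} {v : Form} (h : inRange C L v = true) :
    Sound (vertAt (w := w) hC h) (table C L v) := by
  refine Sound.saturate hC (fun _ _ h => by simp at h) fun p hp => ?_
  rw [List.mem_singleton] at hp
  subst hp
  exact ⟨_, .nil, Nat.zero_le _⟩

lemma exists_reaches_of_edge (hC : 4 ≤ C.c) {T : Table} {L M : FCSLine} {d d' n : ℕ} {s : Site}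
    (hT : closedAt C T L s = true) (hs : s ∈ T L) (hr : s.reaches w d n)
    (hd : 1 ≤ d ∧ d ≤ len C w L)
    (he : FCSEdge (4 + w.x) (4 + w.y) (C.eval w) (L, d) (M, d') ∨
      FCSEdge (4 + w.x) (4 + w.y) (C.eval w) (M, d') (L, d)) :
    ∃ t ∈ T M, t.reaches w d' (n + 1) := by
  simp only [closedAt, Bool.and_eq_true, List.all_eq_true, elim_eq, Bool.or_eq_true] at hT
  obtain ⟨⟨⟨hin, hex⟩, hrung⟩, hsucc⟩ := hT
  unfold Site.reaches at hr
  rcases adj_cases hC he with ⟨rfl, h⟩ | ⟨e, hmem, h1, rfl, rfl⟩ | ⟨hI, rfl, rfl⟩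
  · exact ⟨s, hs, by unfold Site.reaches; omega⟩
  · obtain ⟨t, ht, hr'⟩ := exists_of_covered (hsucc _ (List.mem_append_left _
      (List.mem_map_of_mem (List.mem_filter.2 ⟨hmem, hex e hmem⟩)))) w
    have := eval_absDiff w (hex e hmem)
    refine ⟨t, ht, ?_⟩
    simp only [Site.reaches, eval_add, eval_addConst] at hr' ⊢
    omega
  · have hv := mem_range_of_inRange (w := w) hC hin
    -- crossing at a rung `x` of the list and comparing with the rung at `d`
    have key : ∀ (x : Form) (k : ℕ), inRange C L x = true → (x, k) ∈ rungsNear C L s.v →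
        L.IsRung (x.eval w) → (d + s.h.eval w + k ≤ n + 1 + x.eval w ∧
          x.eval w + s.h.eval w + k ≤ n + 1 + d) →
        ∃ t ∈ T L.mate, t.reaches w (L.across d) (n + 1) := fun x k hx hmem hIx hk => by
      obtain ⟨t, ht, hr'⟩ := exists_of_covered (hsucc _ (List.mem_append_right _
        (List.mem_map_of_mem hmem))) w
      refine ⟨t, ht, ?_⟩
      have hx' := mem_range_of_inRange (w := w) hC hx
      rw [eval_acrossForm (one_le_of_inRange hx), eval_addConst] at hr'
      have hsh : L.across (x.eval w) + d = L.across d + x.eval w := by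
        cases L <;> simp only [across] <;> omega
      simp only [Site.reaches] at hr' ⊢
      omega
    rcases hrung with ho | ⟨⟨ho, hlo⟩, hhi⟩
    · exact key s.v 1 hin (by simp [rungsNear, ho, hin]) (isRung_of_onRung ho w) (by omega)
    · have hI' := isRung_of_onRung ho w
      rw [eval_addConst] at hI'
      have hno : ¬ onRung L s.v = true := fun h =>
        isRung_add_one_iff.1 hI' (isRung_of_onRung h w)
      rw [Bool.not_eq_true] at hno
      have hne : d ≠ s.v.eval w := fun h => isRung_add_one_iff.1 hI' (h ▸ hI)
      have hc := one_le_of_inRange hin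
      rcases lt_or_gt_of_ne hne with hlt | hgt
      · have hlo : inRange C L (s.v.subConst 1) = true := by
          rcases hlo with h | h
          · exact h
          · have := eval_le_eval w h
            rw [eval_const] at this
            omega
        refine key (s.v.subConst 1) 2 hlo (by simp [rungsNear, hno, ho, hlo]) ?_ ?_
        · rw [eval_subConst w hc]
          by_contra hn
          rw [← isRung_add_one_iff, Nat.sub_add_cancel hv.1] at hn
          exact isRung_add_one_iff.1 hI' hn
        · rw [eval_subConst w hc]
          omega
      · have hhi : inRange C L (s.v.addConst 1) = true := by
          rcases hhi with h | h
          · exact h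
          · have := eval_le_eval w h
            rw [eval_length hC] at this
            omega
        refine key (s.v.addConst 1) 2 hhi (by simp [rungsNear, hno, ho, hhi]) ?_ ?_
        · rwa [eval_addConst]
        · rw [eval_addConst]
          omega

/-- Along every walk, some site of a closed table is a lower bound for the length. -/
lemma exists_reaches_of_walk (hC : 4 ≤ C.c) {T : Table} {L : FCSLine} {v : Form}
    (hT : closed C T L v = true) {x y : FCSVertex (4 + w.x) (4 + w.y) (C.eval w)}
    (p : (graph C w).Walk x y) (hy : y.1 = (L, v.eval w)) :
    ∃ s ∈ T x.1.1, s.reaches w x.1.2 p.length := by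
  simp only [closed, Bool.and_eq_true, List.all_eq_true, and_assoc] at hT
  obtain ⟨-, hsrc, hcl⟩ := hT
  induction p with
  | nil =>
    obtain ⟨s, hs, hr⟩ := exists_of_covered hsrc w
    rw [eval_const] at hr
    rw [hy]
    exact ⟨s, hs, hr⟩
  | @cons x x' y hadj p ih =>
    obtain ⟨s, hs, hr⟩ := ih hy
    exact exists_reaches_of_edge hC ((hcl _ (mem_all _)).2 s hs) hs hr x'.2
      (exists_edge_of_adj hadj).symm

/-- The distance to the source of a closed table is at most the value of each site. -/
lemma dist_le_of_reaches (hC : 4 ≤ C.c) {L M : FCSLine} {v : Form} (h : inRange C L v = true)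
    {s : Site} (hs : s ∈ table C L v M) {d n : ℕ} (hd : 1 ≤ d ∧ d ≤ len C w M)
    (hr : s.reaches w d n) : (graph C w).dist (vertAt hC h) (vert M d hd) ≤ n := by
  unfold Site.reaches at hr
  obtain ⟨_, p, hp⟩ := (sound_table (w := w) hC h M s hs).along (k := n - s.h.eval w) hd.1 hd.2
    (by omega) (by omega)
  exact (SimpleGraph.dist_le p).trans (by omega)

/-- The distance to the source of a closed table is at least the value of some site. -/
lemma exists_reaches_dist (hC : 4 ≤ C.c) {L M : FCSLine} {v : Form}
    (hT : closed C (table C L v) L v = true) (h : inRange C L v = true) {d : ℕ}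
    (hd : 1 ≤ d ∧ d ≤ len C w M) :
    ∃ s ∈ table C L v M,
      s.reaches w d ((graph C w).dist (vertAt hC h) (vert M d hd)) := by
  have hne : ∃ s, s ∈ table C L v M := by
    simp only [closed, Bool.and_eq_true, List.all_eq_true] at hT
    exact List.exists_mem_of_ne_nil _ (by simpa using (hT.2 M (mem_all M)).1)
  obtain ⟨s, hs⟩ := hne
  obtain ⟨_, p, -⟩ := (sound_table (w := w) hC h M s hs).along
    (k := s.v.eval w + d) hd.1 hd.2 (by omega) (by omega)
  obtain ⟨q, hq⟩ := (SimpleGraph.Walk.reachable p).symm.exists_walk_length_eq_dist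
  rw [SimpleGraph.dist_comm, ← hq]
  exact exists_reaches_of_walk hC hT q rfl

end Coronoid

/-! ### Two vertices do not resolve the coronoid -/

namespace Coronoid

open FCSLine Form Lin

/-- The position of a vertex on its family, one more than the variable `D`. -/
def here : Lin := ⟨1, 0, 0, 0, 1, 0⟩

/-- The form `d - v + h` for the site `(v, h)`, where `d` is the position of a vertex. -/
def Site.up (s : Site) : Lin := ((ofForm s.h).add here).sub (ofForm s.v)

/-- The form `v - d + h` for the site `(v, h)`. -/
def Site.down (s : Site) : Lin := ((ofForm s.h).add (ofForm s.v)).sub here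

/-- Whether the value of `s` is provably at most that of `t`, under the hypotheses `G`. -/
def siteLe (G : List Lin) (s t : Site) : Bool :=
  (prove G 2 (t.up.sub s.up) || prove G 2 (t.down.sub s.up)) &&
    (prove G 2 (t.up.sub s.down) || prove G 2 (t.down.sub s.down))

/-- Whether the minimum over the sites `Y` is provably at most the minimum over `X`. -/
def sitesLe (G : List Lin) (X Y : List Site) : Bool := X.all fun t => Y.any fun s => siteLe G s t

variable {w : Params} {d e : ℕ}

@[simp] lemma eval_here : here.eval w d e = (1 + d : ℕ) := by
  simp [here, Lin.eval]

lemma eval_up (s : Site) : s.up.eval w d e = s.h.eval w + (1 + d : ℕ) - s.v.eval w := by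
  simp [Site.up]

lemma eval_down (s : Site) : s.down.eval w d e = s.h.eval w + s.v.eval w - (1 + d : ℕ) := by
  simp [Site.down]

lemma exists_reaches_of_sitesLe {G : List Lin} (hG : ∀ g ∈ G, 0 ≤ g.eval w d e)
    {X Y : List Site} (h : sitesLe G X Y = true) {n : ℕ} {t : Site} (ht : t ∈ X)
    (hr : t.reaches w (1 + d) n) : ∃ s ∈ Y, s.reaches w (1 + d) n := by
  obtain ⟨s, hs, h⟩ := List.any_eq_true.1 (List.all_eq_true.1 h t ht)
  refine ⟨s, hs, ?_⟩
  simp only [siteLe, Bool.and_eq_true, Bool.or_eq_true] at h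
  obtain ⟨h1, h2⟩ := h
  unfold Site.reaches at hr ⊢
  constructor
  · rcases h1 with h1 | h1 <;> have := eval_nonneg_of_prove w d e hG h1 <;>
      rw [Lin.eval_sub, eval_up] at this <;> simp only [eval_up, eval_down] at this <;> omega
  · rcases h2 with h1 | h1 <;> have := eval_nonneg_of_prove w d e hG h1 <;>
      rw [Lin.eval_sub, eval_down] at this <;> simp only [eval_up, eval_down] at this <;> omega

/-- The hypothesis that the position is at most the length of the family. -/
def belowLength (C : Form) (L : FCSLine) : Lin := (ofForm (length C L)).sub here

lemma eval_belowLength {C : Form} (hC : 4 ≤ C.c) {L : FCSLine} (hd : 1 + d ≤ len C w L) :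
    0 ≤ (belowLength C L).eval w d e := by
  rw [belowLength, Lin.eval_sub, eval_ofForm, eval_length hC, eval_here]
  omega

/-- The size `c`, at least as large as `b`. -/
def sizeC : Form := ⟨4, 0, 1, 1⟩

lemma four_le_sizeC : 4 ≤ sizeC.c := le_refl 4

/-- The position that has `i` further ones after it. -/
def fromEnd (L : FCSLine) (i : ℕ) : Form := pos sizeC (defect L + i) L

/-- A vertex, given by its family and its position. -/
abbrev Point := FCSLine × Form

/-- The two points are distinct vertices, with valid distance tables. -/
def validPair : Point × Point → Bool
  | ⟨⟨L, v⟩, ⟨M, v'⟩⟩ =>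
    closed sizeC (table sizeC L v) L v && closed sizeC (table sizeC M v') M v' &&
      (!(Nat.beq L.idx M.idx) || (v.addConst 1).le v' || (v'.addConst 1).le v)

/-- Whether the points of the pair provably have the same distance to the vertices of the family
`K`, under the hypotheses `G`. -/
def equidistant (K : FCSLine) (G : List Lin) : Point × Point → Bool
  | ⟨⟨L, v⟩, ⟨M, v'⟩⟩ =>
    sitesLe G (table sizeC L v K) (table sizeC M v' K) &&
      sitesLe G (table sizeC M v' K) (table sizeC L v K)

/-- Pairs of vertices near the corners of the coronoid and the ends of the arms. For any two
vertices, one of these pairs is not resolved by either. -/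
def pairs : List (Point × Point) :=
  [((r2, const 2), (q2, fromEnd q2 0)),
   ((p1, fromEnd p1 2), (p1, fromEnd p1 0)),
   ((r1, fromEnd r1 2), (r1, fromEnd r1 0)),
   ((q2, fromEnd q2 2), (q2, fromEnd q2 0)),
   ((s1, fromEnd s1 0), (q1, const 4)),
   ((t1, const 2), (q1, const 4)),
   ((u2, const 3), (r2, const 5)),
   ((s1, fromEnd s1 3), (p1, fromEnd p1 3)),
   ((s2, fromEnd s2 3), (p2, fromEnd p2 3)),
   ((s1, fromEnd s1 3), (p1, fromEnd p1 5)),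
   ((s2, fromEnd s2 3), (p2, fromEnd p2 5)),
   ((u1, fromEnd u1 3), (r1, fromEnd r1 3)),
   ((t1, const 4), (q1, const 4)),
   ((u1, fromEnd u1 3), (r1, fromEnd r1 5)),
   ((t2, fromEnd t2 3), (q2, fromEnd q2 3)),
   ((u2, const 5), (r2, const 5)),
   ((r3, fromEnd r3 0), (s1, fromEnd s1 0)),
   ((t3, fromEnd t3 0), (s2, fromEnd s2 0)),
   ((q3, fromEnd q3 0), (p2, fromEnd p2 1)),
   ((p3, fromEnd p3 0), (t2, fromEnd t2 0)),
   ((t3, fromEnd t3 1), (q3, fromEnd q3 0)),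
   ((s3, fromEnd s3 1), (p3, fromEnd p3 0)),
   ((r3, fromEnd r3 2), (u3, fromEnd u3 1)),
   ((u3, fromEnd u3 2), (r3, fromEnd r3 1)),
   ((q3, fromEnd q3 2), (t3, fromEnd t3 1)),
   ((s3, fromEnd s3 2), (p3, fromEnd p3 1)),
   ((p3, fromEnd p3 2), (s3, fromEnd s3 1))]

/-- A decision tree for every family, whose leaves name pairs that are not resolved by the vertices
in question. -/
def tree : FCSLine → Tree (List ℕ)
  | p1 =>
    .split ⟨-3, -2, 0, 1, 1, 0⟩
     (.split ⟨3, 2, 0, -1, 0, 0⟩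
      (.split ⟨3, 2, 0, 0, -1, 0⟩
       (.leaf [12, 16, 20, 21, 22, 25])
       (.split ⟨-1, 0, 0, 1, 0, 0⟩
        (.split ⟨5, 2, 0, -1, -1, 0⟩
         (.leaf [8, 12, 20, 21, 22, 25])
         (.leaf [0, 3, 9, 20, 21, 22]))
        (.leaf [0, 8, 9, 15, 20, 21, 22, 25])))
      (.leaf [10, 15, 17, 20, 21, 22]))
     (.leaf [2, 12, 13, 15, 16, 19, 20, 22])
  | p2 =>
    .split ⟨2, 2, 0, 0, -1, 0⟩
     (.leaf [1, 11, 14, 19, 21])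
     (.leaf [6, 7, 10, 14, 20])
  | p3 => .leaf [3, 12, 14, 15]
  | q1 =>
    .split ⟨3, 0, 0, 0, -1, 0⟩
     (.split ⟨-1, 0, 0, 0, 1, 0⟩
      (.leaf [0, 7, 15, 20, 21, 23])
      (.leaf [0, 4, 5, 15, 20, 21, 23, 25]))
     (.split ⟨-5, 0, 0, 0, 1, 0⟩
      (.leaf [3, 7, 12, 21])
      (.leaf [0, 3, 7, 16, 21, 23]))
  | q2 =>
    .split ⟨1, 0, 2, 1, -1, 0⟩
     (.leaf [2, 12, 14, 15, 16, 22])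
     (.split ⟨2, 0, 0, -1, 0, 0⟩
      (.leaf [2, 9, 10, 11, 12, 23, 24, 26])
      (.leaf [2, 10, 11, 12, 17, 18, 20, 23, 26]))
  | q3 =>
    .split ⟨-8, -2, -2, -1, 1, 0⟩
     (.leaf [2, 3, 6, 11, 21])
     (.leaf [1, 2, 4, 7, 11, 14, 22])
  | r1 =>
    .split ⟨-2, 0, 0, 1, 1, 0⟩
     (.split ⟨-3, 0, 0, 1, 0, 0⟩
      (.split ⟨2, 0, 2, 0, -1, 0⟩
       (.leaf [14, 17, 19, 21, 24])
       (.split ⟨3, 0, 0, 0, -1, 0⟩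
        (.leaf [14, 17, 19, 21, 24])
        (.split ⟨3, 0, 2, 0, -1, 0⟩
         (.leaf [14, 17, 19, 21, 24])
         (.split ⟨5, 0, 2, 0, -1, 0⟩
          (.leaf [8, 14, 18, 19, 21, 24])
          (.leaf [3, 7, 10, 14, 19, 25])))))
      (.split ⟨-2, 0, -2, 0, 1, 0⟩
       (.leaf [5, 6, 7, 14, 22, 26])
       (.leaf [3, 6, 8, 11, 16, 17, 23, 26])))
     (.leaf [3, 6, 8, 11, 16, 17, 23, 26])
  | r2 =>
    .split ⟨3, 0, 0, 0, -1, 0⟩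
     (.leaf [2, 6, 10, 11, 12, 21, 23])
     (.leaf [14, 19, 21, 23])
  | r3 => .leaf [3, 7, 12, 21]
  | s1 =>
    .split ⟨3, 2, 0, -1, -1, 0⟩
     (.split ⟨2, 2, 0, -1, -1, 0⟩
      (.leaf [2, 12, 13, 15, 16, 19, 20, 22])
      (.leaf [12, 16, 20, 21, 22, 25]))
     (.split ⟨-1, 0, 0, 1, 0, 0⟩
      (.leaf [3, 12, 20, 21, 22])
      (.leaf [8, 12, 20, 21, 22, 25]))
  | s2 => .leaf [1, 2, 3, 14, 20]
  | s3 => .leaf [3, 12, 14, 15]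
  | t1 =>
    .split ⟨1, 0, 0, 1, -1, 0⟩
     (.leaf [0, 1, 7, 15, 21, 23, 25])
     (.split ⟨0, 0, 0, -1, 0, 0⟩
      (.leaf [0, 3, 7, 16, 21, 23])
      (.split ⟨5, 0, 0, 0, -1, 0⟩
       (.leaf [0, 13, 14, 21, 23, 25])
       (.leaf [3, 13, 14, 17, 23, 24, 25])))
  | t2 =>
    .split ⟨-2, -2, 0, 1, -1, 0⟩
     (.split ⟨3, 2, 0, -1, 1, 0⟩
      (.leaf [2, 12, 16, 19, 20, 22, 25])
      (.leaf [2, 10, 15, 17, 21, 22]))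
     (.split ⟨-3, 0, -2, -2, 1, 0⟩
      (.leaf [3, 12, 14, 15])
      (.split ⟨0, 0, 0, 0, -1, 0⟩
       (.leaf [0, 2, 10, 12, 13, 19, 26])
       (.split ⟨-2, 0, 0, 1, 0, 0⟩
        (.leaf [0, 2, 10, 12, 17, 19, 26])
        (.leaf [0, 2, 10, 12, 19, 24, 26]))))
  | t3 =>
    .split ⟨0, 0, 0, 0, -1, 0⟩
     (.leaf [2, 3, 14, 15, 22])
     (.split ⟨0, 0, 0, -1, 0, 0⟩
      (.leaf [4, 7, 11, 14, 22, 26])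
      (.split ⟨-2, 0, 0, 1, 0, 0⟩
       (.split ⟨3, 0, 0, -1, 0, 0⟩
        (.leaf [2, 4, 7, 8, 14, 22])
        (.split ⟨4, 0, 2, 1, -1, 0⟩
         (.leaf [2, 3, 4, 7, 14, 22])
         (.leaf [2, 3, 7, 21])))
       (.leaf [2, 3, 4, 7, 14, 22])))
  | u1 =>
    .split ⟨2, 0, 0, -1, 0, 0⟩
     (.split ⟨0, 0, 2, 0, -1, 0⟩
      (.leaf [1, 3, 6, 8, 16, 17, 23, 26])
      (.leaf [5, 6, 7, 14, 22, 26]))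
     (.split ⟨2, 0, 2, 0, -1, 0⟩
      (.leaf [14, 17, 19, 21, 24])
      (.leaf [6, 11, 14, 19, 21]))
  | u2 => .leaf [2, 3, 14, 21]
  | u3 => .leaf [2, 3, 7, 21]

/-- The leaves of the decision tree of a family. -/
def leaves (L : FCSLine) : List (List Lin × List ℕ) := (tree L).leaves [belowLength sizeC L]

/-- Whether all pairs named at a leaf are equidistant from the vertices in question. -/
def validLeaf (L : FCSLine) (l : List Lin × List ℕ) : Bool :=
  l.2.all fun i => match pairs[i]? with
    | none => false
    | some p => equidistant L l.1 p

/-- The sets of pairs at all leaves. -/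
def masks : List (List ℕ) := FCSLine.all.flatMap fun L => (leaves L).map Prod.snd

/-- Whether two lists have a common entry. -/
def meet (l m : List ℕ) : Bool := l.any fun i => m.any fun j => Nat.beq i j

lemma meet_of_mem_masks : (masks.all fun l => masks.all fun m => meet l m) = true := by
  decide +kernel

lemma valid_pairs_leaves : (pairs.all validPair &&
    FCSLine.all.all fun L => (leaves L).all (validLeaf L)) = true := by
  decide +kernel

/-- A vertex that does not resolve the two points of a pair. -/
def Unresolved (x : FCSVertex (4 + w.x) (4 + w.y) (sizeC.eval w)) (p : Point × Point) : Prop :=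
  ∀ (h : inRange sizeC p.1.1 p.1.2 = true) (h' : inRange sizeC p.2.1 p.2.2 = true),
    (graph sizeC w).dist x (vertAt four_le_sizeC h) = (graph sizeC w).dist x (vertAt four_le_sizeC h')

lemma exists_mask (K : FCSLine) (d : ℕ) (hd : 1 ≤ d ∧ d ≤ len sizeC w K) :
    ∃ l ∈ masks, ∀ i ∈ l, ∃ p, pairs[i]? = some p ∧ p ∈ pairs ∧ Unresolved (vert K d hd) p := by
  obtain ⟨d, rfl⟩ : ∃ e, d = 1 + e := ⟨d - 1, by omega⟩
  obtain ⟨l, hl, hG⟩ := (tree K).exists_leaf w d 0 [belowLength sizeC K] (by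
    simpa using eval_belowLength four_le_sizeC hd.2)
  have hv := valid_pairs_leaves
  simp only [Bool.and_eq_true, List.all_eq_true] at hv
  have hvalid := hv.2 K (mem_all K) l hl
  refine ⟨l.2, List.mem_flatMap.2 ⟨K, mem_all K, List.mem_map_of_mem hl⟩, fun i hi => ?_⟩
  have hi' := List.all_eq_true.1 hvalid i hi
  split at hi'
  · exact absurd hi' (by decide)
  · rename_i p hp
    have hmem := List.mem_of_getElem? hp
    refine ⟨p, hp, hmem, ?_⟩
    have hpair := hv.1 p hmem
    obtain ⟨⟨L, v⟩, ⟨M, v'⟩⟩ := p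
    simp only [validPair, equidistant, Bool.and_eq_true] at hpair hi'
    intro h h'
    refine SimpleGraph.dist_comm.trans (Eq.trans ?_ SimpleGraph.dist_comm)
    apply le_antisymm
    · obtain ⟨t, ht, hr⟩ := exists_reaches_dist four_le_sizeC hpair.1.2 h' hd
      obtain ⟨s, hs, hr'⟩ := exists_reaches_of_sitesLe hG hi'.2 ht hr
      exact dist_le_of_reaches four_le_sizeC h hs hd hr'
    · obtain ⟨t, ht, hr⟩ := exists_reaches_dist four_le_sizeC hpair.1.1 h hd
      obtain ⟨s, hs, hr'⟩ := exists_reaches_of_sitesLe hG hi'.1 ht hr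
      exact dist_le_of_reaches four_le_sizeC h' hs hd hr'

/-- No two vertices resolve the coronoid. -/
theorem exists_unresolved (x y : FCSVertex (4 + w.x) (4 + w.y) (sizeC.eval w)) :
    ∃ v v', v ≠ v' ∧ (graph sizeC w).dist x v = (graph sizeC w).dist x v' ∧
      (graph sizeC w).dist y v = (graph sizeC w).dist y v' := by
  obtain ⟨l, hl, hlx⟩ := exists_mask x.1.1 x.1.2 x.2
  obtain ⟨m, hm, hmy⟩ := exists_mask y.1.1 y.1.2 y.2
  have hmeet := List.all_eq_true.1 (List.all_eq_true.1 meet_of_mem_masks l hl) m hm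
  obtain ⟨i, hi, hmeet⟩ := List.any_eq_true.1 hmeet
  obtain ⟨j, hj, hij⟩ := List.any_eq_true.1 hmeet
  obtain rfl := Nat.eq_of_beq_eq_true hij
  obtain ⟨p, hp, hmem, hx⟩ := hlx i hi
  obtain ⟨q, hq, -, hy⟩ := hmy i hj
  obtain rfl : p = q := Option.some.inj (hp.symm.trans hq)
  have hv := valid_pairs_leaves
  simp only [Bool.and_eq_true, List.all_eq_true] at hv
  have hpair := hv.1 p hmem
  obtain ⟨⟨L, v⟩, ⟨M, v'⟩⟩ := p
  simp only [validPair, Bool.and_eq_true, Bool.or_eq_true, Bool.not_eq_true'] at hpair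
  obtain ⟨⟨h1, h2⟩, hne⟩ := hpair
  have r1 : inRange sizeC L v = true := by
    simp only [closed, Bool.and_eq_true] at h1; exact h1.1.1
  have r2 : inRange sizeC M v' = true := by
    simp only [closed, Bool.and_eq_true] at h2; exact h2.1.1
  refine ⟨vertAt four_le_sizeC r1, vertAt four_le_sizeC r2, fun heq => ?_, hx r1 r2, hy r1 r2⟩
  have heq' : (L, v.eval w) = (M, v'.eval w) := congrArg Subtype.val heq
  rw [Prod.mk.injEq] at heq'
  rcases hne with (hne | hne) | hne
  · rw [heq'.1, Nat.beq_refl] at hne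
    exact absurd hne (by decide)
  · have := eval_le_eval w hne
    rw [eval_addConst] at this
    omega
  · have := eval_le_eval w hne
    rw [eval_addConst] at this
    omega

end Coronoid

/-! ### Three vertices that resolve the coronoid -/

namespace Coronoid

open FCSLine Form Lin

/-- The distances to three landmarks as linear forms, on a part of a family. -/
structure Values where
  f : Lin
  g : Lin
  h : Lin

/-- Whether `F` is provably the minimum over the sites `X`, under the hypotheses `G`. -/
def isMin (G : List Lin) (X : List Site) (F : Lin) : Bool :=
  (X.any fun s => prove G 3 (F.sub s.up) && prove G 3 (F.sub s.down)) &&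
    X.all fun s => prove G 3 (s.up.sub F) || prove G 3 (s.down.sub F)

/-- Three forms with their sums and differences in pairs. -/
def combinations (e₁ e₂ e₃ : Lin) : List Lin :=
  [e₁.sub e₂, e₁.add e₂, e₂.sub e₃, e₂.add e₃, e₁.sub e₃, e₁.add e₃, e₁, e₂, e₃]

/-- Whether `f ≠ 0` follows from the hypotheses `G`. -/
def neZero (G : List Lin) (n : ℕ) (f : Lin) : Bool :=
  prove G n (f.sub ⟨1, 0, 0, 0, 0, 0⟩) || prove G n f.compl

/-- Whether `e₁ = e₂ = e₃ = 0` contradicts the hypotheses `G`. -/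
def contradictory (G : List Lin) (e₁ e₂ e₃ : Lin) : Bool :=
  (combinations e₁ e₂ e₃).any (neZero [] 0) ||
    ((combinations e₁ e₂ e₃).any (neZero G 1) || (combinations e₁ e₂ e₃).any (neZero G 2))

/-- A part of a family, given by inequalities, on which the distances to the landmarks are known. -/
abbrev Cell := FCSLine × List Lin × Values

/-- Whether distinct vertices in two cells have different distances to some landmark. In the same
family the vertex of the second cell comes after that of the first. -/
def separated : Cell → Cell → Bool
  | ⟨L, G, V⟩, ⟨M, H, W⟩ =>
    bif Nat.ble L.idx M.idx then
      contradictory ((bif Nat.beq L.idx M.idx then [⟨-1, 0, 0, 0, -1, 1⟩] else []) ++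
        (G.map first ++ H.map second))
        (V.f.first.sub W.f.second) (V.g.first.sub W.g.second) (V.h.first.sub W.h.second)
    else true

/-- The cells of all families, the leaves of the trees `t`. -/
def cells (C : Form) (t : FCSLine → Tree Values) : List Cell :=
  FCSLine.all.flatMap fun L => ((t L).leaves [belowLength C L]).map fun l => (L, l)

/-- Whether the distances to the three points on a cell are the stated ones. -/
def validCell (C : Form) : Point → Point → Point → Cell → Bool
  | ⟨L₁, v₁⟩, ⟨L₂, v₂⟩, ⟨L₃, v₃⟩, ⟨K, G, V⟩ =>
    isMin G (table C L₁ v₁ K) V.f && (isMin G (table C L₂ v₂ K) V.g &&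
      isMin G (table C L₃ v₃ K) V.h)

/-- Whether the three distance tables are closed. -/
def closedAll (C : Form) : Point → Point → Point → Bool
  | ⟨L₁, v₁⟩, ⟨L₂, v₂⟩, ⟨L₃, v₃⟩ => closed C (table C L₁ v₁) L₁ v₁ &&
      (closed C (table C L₂ v₂) L₂ v₂ && closed C (table C L₃ v₃) L₃ v₃)

/-- Whether the decision trees `t` show that the three points resolve the coronoid. -/
def resolving (C : Form) (p₁ p₂ p₃ : Point) (t : FCSLine → Tree Values) : Bool :=
  closedAll C p₁ p₂ p₃ && (cells C t).all (validCell C p₁ p₂ p₃) &&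
    (cells C t).all fun a => (cells C t).all fun b => separated a b

variable {C : Form} {w : Params} {d e : ℕ}

lemma eval_eq_dist (hC : 4 ≤ C.c) {G : List Lin} (hG : ∀ g ∈ G, 0 ≤ g.eval w d 0)
    {L K : FCSLine} {v : Form} (hT : closed C (table C L v) L v = true)
    (h : inRange C L v = true) {F : Lin} (hF : isMin G (table C L v K) F = true)
    (hd : 1 ≤ 1 + d ∧ 1 + d ≤ len C w K) :
    F.eval w d 0 = (graph C w).dist (vertAt hC h) (vert K (1 + d) hd) := by
  simp only [isMin, Bool.and_eq_true, List.any_eq_true, List.all_eq_true, Bool.or_eq_true] at hF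
  obtain ⟨⟨s, hs, h1, h2⟩, hle⟩ := hF
  have h1 := eval_nonneg_of_prove w d 0 hG h1
  have h2 := eval_nonneg_of_prove w d 0 hG h2
  rw [Lin.eval_sub, eval_up] at h1
  rw [Lin.eval_sub, eval_down] at h2
  apply le_antisymm
  · obtain ⟨t, ht, hr⟩ := exists_reaches_dist hC hT h hd
    unfold Site.reaches at hr
    rcases hle t ht with h3 | h3 <;> have h3 := eval_nonneg_of_prove w d 0 hG h3 <;>
      rw [Lin.eval_sub] at h3 <;> simp only [eval_up, eval_down] at h3 <;> omega
  · have hpos : 0 ≤ F.eval w d 0 := by omega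
    have := dist_le_of_reaches hC h hs hd (n := (F.eval w d 0).toNat)
      (by unfold Site.reaches; omega)
    omega

lemma eval_ne_zero_of_neZero {G : List Lin} (hG : ∀ g ∈ G, 0 ≤ g.eval w d e) {n : ℕ} {f : Lin}
    (h : neZero G n f = true) : f.eval w d e ≠ 0 := by
  simp only [neZero, Bool.or_eq_true] at h
  rcases h with h | h <;> have := eval_nonneg_of_prove w d e hG h
  · rw [Lin.eval_sub] at this
    simp only [Lin.eval] at this ⊢
    omega
  · rw [eval_compl] at this
    omega

lemma not_contradictory {G : List Lin} (hG : ∀ g ∈ G, 0 ≤ g.eval w d e) {e₁ e₂ e₃ : Lin}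
    (h₁ : e₁.eval w d e = 0) (h₂ : e₂.eval w d e = 0) (h₃ : e₃.eval w d e = 0) :
    ¬ contradictory G e₁ e₂ e₃ = true := by
  have h : ∀ f ∈ combinations e₁ e₂ e₃, f.eval w d e = 0 := by
    simp [combinations, h₁, h₂, h₃]
  simp only [contradictory, Bool.or_eq_true, List.any_eq_true]
  rintro (⟨f, hf, h'⟩ | ⟨f, hf, h'⟩ | ⟨f, hf, h'⟩)
  · exact eval_ne_zero_of_neZero (G := []) (by simp) h' (h f hf)
  · exact eval_ne_zero_of_neZero hG h' (h f hf)
  · exact eval_ne_zero_of_neZero hG h' (h f hf)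

lemma exists_cell (hC : 4 ≤ C.c) (t : FCSLine → Tree Values) {K : FCSLine}
    (hd : 1 ≤ 1 + d ∧ 1 + d ≤ len C w K) :
    ∃ G V, (K, G, V) ∈ cells C t ∧ ∀ g ∈ G, 0 ≤ g.eval w d 0 := by
  obtain ⟨⟨G, V⟩, hl, hG⟩ := (t K).exists_leaf w d 0 [belowLength C K] (by
    simpa using eval_belowLength hC hd.2)
  exact ⟨G, V, List.mem_flatMap.2 ⟨K, mem_all K, List.mem_map.2 ⟨_, hl, rfl⟩⟩, hG⟩

/-- The landmarks resolve two vertices that are given in order. -/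
lemma exists_dist_ne_of_lt (hC : 4 ≤ C.c) {p₁ p₂ p₃ : Point} {t : FCSLine → Tree Values}
    (ht : resolving C p₁ p₂ p₃ t = true) (h₁ : inRange C p₁.1 p₁.2 = true)
    (h₂ : inRange C p₂.1 p₂.2 = true) (h₃ : inRange C p₃.1 p₃.2 = true) {K M : FCSLine}
    (hd : 1 ≤ 1 + d ∧ 1 + d ≤ len C w K) (he : 1 ≤ 1 + e ∧ 1 + e ≤ len C w M)
    (hlt : K.idx < M.idx ∨ K = M ∧ d < e) :
    ∃ u ∈ ({vertAt hC h₁, vertAt hC h₂, vertAt hC h₃} : Set (FCSVertex _ _ _)),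
      (graph C w).dist u (vert K (1 + d) hd) ≠ (graph C w).dist u (vert M (1 + e) he) := by
  by_contra! hcon
  have c₁ := hcon (vertAt hC h₁) (by simp)
  have c₂ := hcon (vertAt hC h₂) (by simp)
  have c₃ := hcon (vertAt hC h₃) (by simp)
  simp only [resolving, Bool.and_eq_true, List.all_eq_true] at ht
  obtain ⟨⟨hclosed, hvalid⟩, hsep⟩ := ht
  obtain ⟨G, V, hV, hG⟩ := exists_cell hC t hd
  obtain ⟨H, W, hW, hH⟩ := exists_cell hC t he
  have v1 := hvalid _ hV
  have v2 := hvalid _ hW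
  have hs := hsep _ hV _ hW
  obtain ⟨L₁, v₁⟩ := p₁
  obtain ⟨L₂, v₂⟩ := p₂
  obtain ⟨L₃, v₃⟩ := p₃
  simp only [closedAll, validCell, Bool.and_eq_true] at hclosed v1 v2
  have f1 := eval_eq_dist hC hG hclosed.1 h₁ v1.1 hd
  have f2 := eval_eq_dist hC hG hclosed.2.1 h₂ v1.2.1 hd
  have f3 := eval_eq_dist hC hG hclosed.2.2 h₃ v1.2.2 hd
  have g1 := eval_eq_dist hC hH hclosed.1 h₁ v2.1 he
  have g2 := eval_eq_dist hC hH hclosed.2.1 h₂ v2.2.1 he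
  have g3 := eval_eq_dist hC hH hclosed.2.2 h₃ v2.2.2 he
  have hle : Nat.ble K.idx M.idx = true := by
    rw [Nat.ble_eq]
    rcases hlt with h | ⟨rfl, -⟩ <;> omega
  rw [separated, hle, cond_true] at hs
  refine not_contradictory (w := w) (d := d) (e := e) ?_ ?_ ?_ ?_ hs
  · intro g hg
    rcases List.mem_append.1 hg with hg | hg
    · cases hb : Nat.beq K.idx M.idx <;> rw [hb] at hg
      · simp at hg
      · have hKM := Nat.eq_of_beq_eq_true hb
        rw [cond_true, List.mem_singleton] at hg
        subst hg
        simp only [Lin.eval]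
        omega
    · rcases List.mem_append.1 hg with hg | hg
      · obtain ⟨f, hf, rfl⟩ := List.mem_map.1 hg
        rw [eval_first]
        exact hG f hf
      · obtain ⟨f, hf, rfl⟩ := List.mem_map.1 hg
        rw [eval_second]
        exact hH f hf
  · rw [Lin.eval_sub, eval_first, eval_second, f1, g1]
    exact sub_eq_zero.2 (congrArg _ c₁)
  · rw [Lin.eval_sub, eval_first, eval_second, f2, g2]
    exact sub_eq_zero.2 (congrArg _ c₂)
  · rw [Lin.eval_sub, eval_first, eval_second, f3, g3]
    exact sub_eq_zero.2 (congrArg _ c₃)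

lemma isMetricGenerator_of_resolving (hC : 4 ≤ C.c) {p₁ p₂ p₃ : Point}
    {t : FCSLine → Tree Values} (ht : resolving C p₁ p₂ p₃ t = true)
    (h₁ : inRange C p₁.1 p₁.2 = true) (h₂ : inRange C p₂.1 p₂.2 = true)
    (h₃ : inRange C p₃.1 p₃.2 = true) :
    (graph C w).IsMetricGenerator {vertAt hC h₁, vertAt hC h₂, vertAt hC h₃} := by
  intro x y hxy
  obtain ⟨⟨K, d⟩, hd⟩ := x
  obtain ⟨⟨M, e⟩, he⟩ := y
  obtain ⟨d, rfl⟩ : ∃ k, d = 1 + k := ⟨d - 1, by have := hd.1; simp only at this; omega⟩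
  obtain ⟨e, rfl⟩ : ∃ k, e = 1 + k := ⟨e - 1, by have := he.1; simp only at this; omega⟩
  have htri : (K.idx < M.idx ∨ K = M ∧ d < e) ∨ (M.idx < K.idx ∨ M = K ∧ e < d) := by
    rcases lt_trichotomy K.idx M.idx with h | h | h
    · exact .inl (.inl h)
    · obtain rfl := idx_injective h
      have hne : d ≠ e := fun h => hxy (by subst h; rfl)
      rcases lt_or_gt_of_ne hne with h | h
      · exact .inl (.inr ⟨rfl, h⟩)
      · exact .inr (.inr ⟨rfl, h⟩)
    · exact .inr (.inl h)
  rcases htri with h | h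
  · exact exists_dist_ne_of_lt hC ht h₁ h₂ h₃ hd he h
  · obtain ⟨u, hu, hne⟩ := exists_dist_ne_of_lt hC ht h₁ h₂ h₃ he hd h
    exact ⟨u, hu, hne.symm⟩

/-- The size `c = b + 2Z + k`. -/
def sizeOfParity (k : ℕ) : Form := ⟨4 + k, 0, 1, 2⟩

/-- The distances to the landmarks, if `c - b` is even. -/
def evenTree : FCSLine → Tree Values
  | p1 =>
    .split ⟨4, 2, 0, 0, -1, 0⟩
     (.split ⟨0, 0, 0, 0, -1, 0⟩
      (.split ⟨0, 1, 0, -1, 0, 0⟩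
       (.leaf ⟨⟨3, 0, 0, 2, -1, 0⟩, ⟨9, 2, 0, 2, -1, 0⟩, ⟨17, 2, 4, 4, -1, 0⟩⟩)
       (.leaf ⟨⟨3, 0, 0, 2, -1, 0⟩, ⟨9, 2, 0, 2, -1, 0⟩, ⟨21, 6, 4, 0, -1, 0⟩⟩))
      (.split ⟨0, 1, 0, -1, 0, 0⟩
       (.split ⟨2, 2, 0, 0, -1, 0⟩
        (.leaf ⟨⟨1, 0, 0, 2, 1, 0⟩, ⟨9, 2, 0, 2, -1, 0⟩, ⟨17, 2, 4, 4, -1, 0⟩⟩)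
        (.leaf ⟨⟨1, 0, 0, 2, 1, 0⟩, ⟨9, 2, 0, 2, -1, 0⟩, ⟨11, -2, 4, 4, 1, 0⟩⟩))
       (.split ⟨2, 2, 0, 0, -1, 0⟩
        (.leaf ⟨⟨1, 0, 0, 2, 1, 0⟩, ⟨9, 2, 0, 2, -1, 0⟩, ⟨21, 6, 4, 0, -1, 0⟩⟩)
        (.leaf ⟨⟨1, 0, 0, 2, 1, 0⟩, ⟨9, 2, 0, 2, -1, 0⟩, ⟨15, 2, 4, 0, 1, 0⟩⟩))))
     (.split ⟨0, 1, 0, -1, 0, 0⟩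
      (.leaf ⟨⟨1, 0, 0, 2, 1, 0⟩, ⟨-1, -2, 0, 2, 1, 0⟩, ⟨9, -2, 4, 4, 1, 0⟩⟩)
      (.leaf ⟨⟨1, 0, 0, 2, 1, 0⟩, ⟨-1, -2, 0, 2, 1, 0⟩, ⟨13, 2, 4, 0, 1, 0⟩⟩))
  | p2 =>
    .split ⟨4, 2, 0, 0, -1, 0⟩
     (.split ⟨0, 0, 0, 0, -1, 0⟩
      (.leaf ⟨⟨12, 0, 4, 2, -1, 0⟩, ⟨14, 2, 4, 2, -1, 0⟩, ⟨4, 2, 0, 0, -1, 0⟩⟩)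
      (.leaf ⟨⟨10, 0, 4, 2, 1, 0⟩, ⟨14, 2, 4, 2, -1, 0⟩, ⟨4, 2, 0, 0, -1, 0⟩⟩))
     (.split ⟨0, 0, 0, -1, 0, 0⟩
      (.leaf ⟨⟨8, 0, 4, 6, 1, 0⟩, ⟨4, -2, 4, 2, 1, 0⟩, ⟨-4, -2, 0, 0, 1, 0⟩⟩)
      (.leaf ⟨⟨10, 0, 4, 2, 1, 0⟩, ⟨4, -2, 4, 2, 1, 0⟩, ⟨-4, -2, 0, 0, 1, 0⟩⟩))
  | p3 =>
    .split ⟨1, 2, 0, -2, -1, 0⟩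
     (.leaf ⟨⟨6, 2, 2, 2, -1, 0⟩, ⟨6, 0, 2, 2, 1, 0⟩, ⟨8, 0, 2, 4, 1, 0⟩⟩)
     (.leaf ⟨⟨6, 2, 2, 2, -1, 0⟩, ⟨6, 0, 2, 2, 1, 0⟩, ⟨12, 4, 2, 0, -1, 0⟩⟩)
  | q1 =>
    .split ⟨0, 0, 0, 0, -1, 0⟩
     (.split ⟨1, 1, 0, -1, 0, 0⟩
      (.leaf ⟨⟨8, 2, 0, 2, -1, 0⟩, ⟨4, 0, 0, 2, -1, 0⟩, ⟨14, 0, 4, 4, -1, 0⟩⟩)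
      (.leaf ⟨⟨8, 2, 0, 2, -1, 0⟩, ⟨4, 0, 0, 2, -1, 0⟩, ⟨20, 4, 4, 0, -1, 0⟩⟩))
     (.split ⟨2, 0, 0, 2, -1, 0⟩
      (.split ⟨1, 2, 0, -2, 1, 0⟩
       (.leaf ⟨⟨6, 2, 0, 2, 1, 0⟩, ⟨4, 0, 0, 2, -1, 0⟩, ⟨14, 0, 4, 4, -1, 0⟩⟩)
       (.split ⟨2, 0, 0, 0, -1, 0⟩
        (.leaf ⟨⟨6, 2, 0, 2, 1, 0⟩, ⟨4, 0, 0, 2, -1, 0⟩, ⟨18, 4, 4, 0, 1, 0⟩⟩)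
        (.leaf ⟨⟨6, 2, 0, 2, 1, 0⟩, ⟨4, 0, 0, 2, -1, 0⟩, ⟨16, 4, 4, 0, 1, 0⟩⟩)))
      (.split ⟨4, 0, 2, 4, -1, 0⟩
       (.split ⟨9, 0, 4, 2, -1, 0⟩
        (.leaf ⟨⟨6, 2, 0, 2, 1, 0⟩, ⟨-2, 0, 0, -2, 1, 0⟩, ⟨14, 0, 4, 4, -1, 0⟩⟩)
        (.leaf ⟨⟨26, 2, 8, 6, -1, 0⟩, ⟨-2, 0, 0, -2, 1, 0⟩, ⟨14, 0, 4, 4, -1, 0⟩⟩))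
       (.split ⟨2, 0, 1, -1, 0, 0⟩
        (.leaf ⟨⟨6, 2, 0, 2, 1, 0⟩, ⟨-2, 0, 0, -2, 1, 0⟩, ⟨4, 0, 0, -4, 1, 0⟩⟩)
        (.leaf ⟨⟨16, 2, 4, -2, 1, 0⟩, ⟨-2, 0, 0, -2, 1, 0⟩, ⟨4, 0, 0, -4, 1, 0⟩⟩))))
  | q2 =>
    .split ⟨4, 0, 2, 4, -1, 0⟩
     (.split ⟨0, 0, 0, 2, -1, 0⟩
      (.split ⟨0, 0, 0, 0, -1, 0⟩
       (.split ⟨1, 1, 0, -1, 0, 0⟩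
        (.leaf ⟨⟨2, 0, 0, 2, -1, 0⟩, ⟨10, 2, 0, 2, -1, 0⟩, ⟨16, 2, 4, 4, -1, 0⟩⟩)
        (.leaf ⟨⟨2, 0, 0, 2, -1, 0⟩, ⟨10, 2, 0, 2, -1, 0⟩, ⟨22, 6, 4, 0, -1, 0⟩⟩))
       (.split ⟨1, 2, 0, -2, 1, 0⟩
        (.leaf ⟨⟨2, 0, 0, 2, -1, 0⟩, ⟨8, 2, 0, 2, 1, 0⟩, ⟨16, 2, 4, 4, -1, 0⟩⟩)
        (.leaf ⟨⟨2, 0, 0, 2, -1, 0⟩, ⟨8, 2, 0, 2, 1, 0⟩, ⟨20, 6, 4, 0, 1, 0⟩⟩)))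
      (.split ⟨2, 0, 2, 2, -1, 0⟩
       (.leaf ⟨⟨0, 0, 0, -2, 1, 0⟩, ⟨8, 2, 0, 2, 1, 0⟩, ⟨16, 2, 4, 4, -1, 0⟩⟩)
       (.split ⟨2, 0, 2, 4, -1, 0⟩
        (.leaf ⟨⟨0, 0, 0, -2, 1, 0⟩, ⟨14, 2, 4, 6, -1, 0⟩, ⟨16, 2, 4, 4, -1, 0⟩⟩)
        (.leaf ⟨⟨0, 0, 0, -2, 1, 0⟩, ⟨8, 2, 0, -2, 1, 0⟩, ⟨16, 2, 4, 4, -1, 0⟩⟩))))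
     (.leaf ⟨⟨0, 0, 0, -2, 1, 0⟩, ⟨6, 2, 0, -2, 1, 0⟩, ⟨6, 2, 0, -4, 1, 0⟩⟩)
  | q3 =>
    .split ⟨1, 0, 2, 2, -1, 0⟩
     (.split ⟨2, 2, 0, -2, 1, 0⟩
      (.leaf ⟨⟨9, 2, 2, 2, 1, 0⟩, ⟨5, 0, 2, 2, 1, 0⟩, ⟨7, 0, 2, 4, -1, 0⟩⟩)
      (.leaf ⟨⟨9, 2, 2, 2, 1, 0⟩, ⟨5, 0, 2, 2, 1, 0⟩, ⟨13, 4, 2, 0, 1, 0⟩⟩))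
     (.split ⟨3, 0, 2, 2, -1, 0⟩
      (.leaf ⟨⟨9, 2, 2, 2, 1, 0⟩, ⟨9, 0, 6, 6, -1, 0⟩, ⟨7, 0, 2, 4, -1, 0⟩⟩)
      (.leaf ⟨⟨17, 2, 6, 6, -1, 0⟩, ⟨9, 0, 6, 6, -1, 0⟩, ⟨7, 0, 2, 4, -1, 0⟩⟩))
  | r1 =>
    .split ⟨0, 0, 0, 0, -1, 0⟩
     (.split ⟨1, 0, 1, -1, 0, 0⟩
      (.leaf ⟨⟨13, 2, 2, 6, -1, 0⟩, ⟨5, 0, 2, 2, -1, 0⟩, ⟨9, 0, 2, 0, -1, 0⟩⟩)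
      (.leaf ⟨⟨21, 2, 6, 2, -1, 0⟩, ⟨5, 0, 2, 2, -1, 0⟩, ⟨9, 0, 2, 0, -1, 0⟩⟩))
     (.split ⟨4, 0, 2, -2, -1, 0⟩
      (.leaf ⟨⟨11, 2, 2, 6, 1, 0⟩, ⟨3, 0, 2, 2, 1, 0⟩, ⟨9, 0, 2, 0, -1, 0⟩⟩)
      (.split ⟨0, 0, 0, -1, 0, 0⟩
       (.leaf ⟨⟨9, 2, 2, 6, 1, 0⟩, ⟨3, 0, 2, 2, 1, 0⟩, ⟨9, 0, 2, 0, -1, 0⟩⟩)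
       (.split ⟨4, 0, 2, 0, -1, 0⟩
        (.leaf ⟨⟨21, 2, 6, 2, -1, 0⟩, ⟨3, 0, 2, 2, 1, 0⟩, ⟨9, 0, 2, 0, -1, 0⟩⟩)
        (.leaf ⟨⟨11, 2, 2, 2, 1, 0⟩, ⟨3, 0, 2, 2, 1, 0⟩, ⟨9, 0, 2, 0, -1, 0⟩⟩))))
  | r2 =>
    .split ⟨0, 0, 0, 0, -1, 0⟩
     (.leaf ⟨⟨7, 0, 2, 2, -1, 0⟩, ⟨13, 2, 2, 2, -1, 0⟩, ⟨11, 2, 2, 0, -1, 0⟩⟩)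
     (.split ⟨2, 0, 0, 0, -1, 0⟩
      (.leaf ⟨⟨5, 0, 2, 2, 1, 0⟩, ⟨11, 2, 2, 2, 1, 0⟩, ⟨11, 2, 2, 0, -1, 0⟩⟩)
      (.leaf ⟨⟨5, 0, 2, 2, 1, 0⟩, ⟨9, 2, 2, 2, 1, 0⟩, ⟨11, 2, 2, 0, -1, 0⟩⟩))
  | r3 =>
    .split ⟨0, 1, 0, -1, 0, 0⟩
     (.leaf ⟨⟨7, 2, 2, 2, -1, 0⟩, ⟨5, 0, 2, 2, -1, 0⟩, ⟨9, 0, 2, 4, 1, 0⟩⟩)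
     (.leaf ⟨⟨7, 2, 2, 2, -1, 0⟩, ⟨5, 0, 2, 2, -1, 0⟩, ⟨13, 4, 2, 0, 1, 0⟩⟩)
  | s1 =>
    .split ⟨0, 1, 0, -1, 0, 0⟩
     (.split ⟨2, 2, 0, 0, -1, 0⟩
      (.leaf ⟨⟨1, 0, 0, 2, 1, 0⟩, ⟨7, 2, 0, 2, -1, 0⟩, ⟨15, 2, 4, 4, -1, 0⟩⟩)
      (.leaf ⟨⟨1, 0, 0, 2, 1, 0⟩, ⟨7, 2, 0, 2, -1, 0⟩, ⟨9, -2, 4, 4, 1, 0⟩⟩))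
     (.split ⟨2, 2, 0, 0, -1, 0⟩
      (.leaf ⟨⟨1, 0, 0, 2, 1, 0⟩, ⟨7, 2, 0, 2, -1, 0⟩, ⟨19, 6, 4, 0, -1, 0⟩⟩)
      (.leaf ⟨⟨1, 0, 0, 2, 1, 0⟩, ⟨7, 2, 0, 2, -1, 0⟩, ⟨13, 2, 4, 0, 1, 0⟩⟩))
  | s2 =>
    .split ⟨2, 2, 0, 0, -1, 0⟩
     (.leaf ⟨⟨10, 0, 4, 2, 1, 0⟩, ⟨12, 2, 4, 2, -1, 0⟩, ⟨4, 2, 0, 0, -1, 0⟩⟩)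
     (.split ⟨0, 0, 0, -1, 0, 0⟩
      (.leaf ⟨⟨8, 0, 4, 6, 1, 0⟩, ⟨12, 2, 4, 2, -1, 0⟩, ⟨6, 2, 0, 0, -1, 0⟩⟩)
      (.leaf ⟨⟨10, 0, 4, 2, 1, 0⟩, ⟨12, 2, 4, 2, -1, 0⟩, ⟨6, 2, 0, 0, -1, 0⟩⟩))
  | s3 =>
    .split ⟨1, 2, 0, -2, -1, 0⟩
     (.leaf ⟨⟨7, 2, 2, 2, -1, 0⟩, ⟨7, 0, 2, 2, 1, 0⟩, ⟨7, 0, 2, 4, 1, 0⟩⟩)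
     (.leaf ⟨⟨7, 2, 2, 2, -1, 0⟩, ⟨7, 0, 2, 2, 1, 0⟩, ⟨11, 4, 2, 0, -1, 0⟩⟩)
  | t1 =>
    .split ⟨1, 0, 0, 2, -1, 0⟩
     (.split ⟨2, 2, 0, -2, 1, 0⟩
      (.leaf ⟨⟨6, 2, 0, 2, 1, 0⟩, ⟨2, 0, 0, 2, -1, 0⟩, ⟨12, 0, 4, 4, -1, 0⟩⟩)
      (.split ⟨0, 0, 0, 0, -1, 0⟩
       (.leaf ⟨⟨6, 2, 0, 2, 1, 0⟩, ⟨2, 0, 0, 2, -1, 0⟩, ⟨18, 4, 4, 0, -1, 0⟩⟩)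
       (.leaf ⟨⟨6, 2, 0, 2, 1, 0⟩, ⟨2, 0, 0, 2, -1, 0⟩, ⟨16, 4, 4, 0, 1, 0⟩⟩)))
     (.split ⟨8, 0, 4, 2, -1, 0⟩
      (.leaf ⟨⟨6, 2, 0, 2, 1, 0⟩, ⟨-2, 0, 0, -2, 1, 0⟩, ⟨12, 0, 4, 4, -1, 0⟩⟩)
      (.leaf ⟨⟨24, 2, 8, 6, -1, 0⟩, ⟨-2, 0, 0, -2, 1, 0⟩, ⟨12, 0, 4, 4, -1, 0⟩⟩))
  | t2 =>
    .split ⟨0, 0, 0, -2, 1, 0⟩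
     (.split ⟨1, 0, 2, 2, -1, 0⟩
      (.leaf ⟨⟨0, 0, 0, -2, 1, 0⟩, ⟨8, 2, 0, 2, 1, 0⟩, ⟨14, 2, 4, 4, -1, 0⟩⟩)
      (.split ⟨2, 0, 2, 4, -1, 0⟩
       (.leaf ⟨⟨0, 0, 0, -2, 1, 0⟩, ⟨12, 2, 4, 6, -1, 0⟩, ⟨14, 2, 4, 4, -1, 0⟩⟩)
       (.leaf ⟨⟨0, 0, 0, -2, 1, 0⟩, ⟨6, 2, 0, -2, 1, 0⟩, ⟨14, 2, 4, 4, -1, 0⟩⟩)))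
     (.split ⟨2, 2, 0, -2, 1, 0⟩
      (.leaf ⟨⟨0, 0, 0, 2, -1, 0⟩, ⟨8, 2, 0, 2, 1, 0⟩, ⟨14, 2, 4, 4, -1, 0⟩⟩)
      (.leaf ⟨⟨0, 0, 0, 2, -1, 0⟩, ⟨8, 2, 0, 2, 1, 0⟩, ⟨20, 6, 4, 0, 1, 0⟩⟩))
  | t3 =>
    .split ⟨1, 0, 2, 2, -1, 0⟩
     (.split ⟨2, 2, 0, -2, 1, 0⟩
      (.leaf ⟨⟨8, 2, 2, 2, 1, 0⟩, ⟨6, 0, 2, 2, 1, 0⟩, ⟨6, 0, 2, 4, -1, 0⟩⟩)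
      (.leaf ⟨⟨8, 2, 2, 2, 1, 0⟩, ⟨6, 0, 2, 2, 1, 0⟩, ⟨12, 4, 2, 0, 1, 0⟩⟩))
     (.split ⟨3, 0, 2, 2, -1, 0⟩
      (.leaf ⟨⟨8, 2, 2, 2, 1, 0⟩, ⟨10, 0, 6, 6, -1, 0⟩, ⟨6, 0, 2, 4, -1, 0⟩⟩)
      (.leaf ⟨⟨16, 2, 6, 6, -1, 0⟩, ⟨10, 0, 6, 6, -1, 0⟩, ⟨6, 0, 2, 4, -1, 0⟩⟩))
  | u1 =>
    .split ⟨2, 0, 2, 2, -1, 0⟩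
     (.split ⟨4, 0, 2, -2, -1, 0⟩
      (.split ⟨0, 0, 0, -1, 0, 0⟩
       (.leaf ⟨⟨11, 2, 2, 6, 1, 0⟩, ⟨3, 0, 2, 2, 1, 0⟩, ⟨7, 0, 2, 0, -1, 0⟩⟩)
       (.leaf ⟨⟨11, 2, 2, 6, 1, 0⟩, ⟨3, 0, 2, 2, 1, 0⟩, ⟨7, 0, 2, 0, -1, 0⟩⟩))
      (.leaf ⟨⟨19, 2, 6, 2, -1, 0⟩, ⟨3, 0, 2, 2, 1, 0⟩, ⟨7, 0, 2, 0, -1, 0⟩⟩))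
     (.leaf ⟨⟨9, 2, 2, 6, 1, 0⟩, ⟨3, 0, 2, 2, 1, 0⟩, ⟨7, 0, 2, 0, -1, 0⟩⟩)
  | u2 =>
    .split ⟨0, 0, 0, 0, -1, 0⟩
     (.leaf ⟨⟨5, 0, 2, 2, 1, 0⟩, ⟨11, 2, 2, 2, -1, 0⟩, ⟨9, 2, 2, 0, -1, 0⟩⟩)
     (.leaf ⟨⟨5, 0, 2, 2, 1, 0⟩, ⟨9, 2, 2, 2, 1, 0⟩, ⟨9, 2, 2, 0, -1, 0⟩⟩)
  | u3 =>
    .split ⟨1, 1, 0, -1, 0, 0⟩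
     (.leaf ⟨⟨8, 2, 2, 2, -1, 0⟩, ⟨4, 0, 2, 2, -1, 0⟩, ⟨8, 0, 2, 4, 1, 0⟩⟩)
     (.leaf ⟨⟨8, 2, 2, 2, -1, 0⟩, ⟨4, 0, 2, 2, -1, 0⟩, ⟨14, 4, 2, 0, 1, 0⟩⟩)

/-- The distances to the landmarks, if `c - b` is odd. -/
def oddTree : FCSLine → Tree Values
  | p1 =>
    .split ⟨4, 2, 0, 0, -1, 0⟩
     (.split ⟨0, 0, 0, 0, -1, 0⟩
      (.split ⟨0, 1, 0, -1, 0, 0⟩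
       (.leaf ⟨⟨4, 0, 0, 2, -1, 0⟩, ⟨10, 2, 0, 2, -1, 0⟩, ⟨19, 2, 4, 4, -1, 0⟩⟩)
       (.leaf ⟨⟨4, 0, 0, 2, -1, 0⟩, ⟨10, 2, 0, 2, -1, 0⟩, ⟨21, 6, 4, 0, -1, 0⟩⟩))
      (.split ⟨0, 1, 0, -1, 0, 0⟩
       (.split ⟨2, 2, 0, 0, -1, 0⟩
        (.leaf ⟨⟨2, 0, 0, 2, 1, 0⟩, ⟨10, 2, 0, 2, -1, 0⟩, ⟨19, 2, 4, 4, -1, 0⟩⟩)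
        (.leaf ⟨⟨2, 0, 0, 2, 1, 0⟩, ⟨10, 2, 0, 2, -1, 0⟩, ⟨13, -2, 4, 4, 1, 0⟩⟩))
       (.split ⟨2, 2, 0, 0, -1, 0⟩
        (.leaf ⟨⟨2, 0, 0, 2, 1, 0⟩, ⟨10, 2, 0, 2, -1, 0⟩, ⟨21, 6, 4, 0, -1, 0⟩⟩)
        (.leaf ⟨⟨2, 0, 0, 2, 1, 0⟩, ⟨10, 2, 0, 2, -1, 0⟩, ⟨15, 2, 4, 0, 1, 0⟩⟩))))
     (.split ⟨0, 1, 0, -1, 0, 0⟩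
      (.leaf ⟨⟨2, 0, 0, 2, 1, 0⟩, ⟨0, -2, 0, 2, 1, 0⟩, ⟨11, -2, 4, 4, 1, 0⟩⟩)
      (.leaf ⟨⟨2, 0, 0, 2, 1, 0⟩, ⟨0, -2, 0, 2, 1, 0⟩, ⟨13, 2, 4, 0, 1, 0⟩⟩))
  | p2 =>
    .split ⟨4, 2, 0, 0, -1, 0⟩
     (.split ⟨0, 0, 0, 0, -1, 0⟩
      (.leaf ⟨⟨13, 0, 4, 2, -1, 0⟩, ⟨15, 2, 4, 2, -1, 0⟩, ⟨4, 2, 0, 0, -1, 0⟩⟩)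
      (.leaf ⟨⟨11, 0, 4, 2, 1, 0⟩, ⟨15, 2, 4, 2, -1, 0⟩, ⟨4, 2, 0, 0, -1, 0⟩⟩))
     (.leaf ⟨⟨11, 0, 4, 2, 1, 0⟩, ⟨5, -2, 4, 2, 1, 0⟩, ⟨-4, -2, 0, 0, 1, 0⟩⟩)
  | p3 =>
    .split ⟨0, 2, 0, -2, -1, 0⟩
     (.leaf ⟨⟨7, 2, 2, 2, -1, 0⟩, ⟨7, 0, 2, 2, 1, 0⟩, ⟨10, 0, 2, 4, 1, 0⟩⟩)
     (.leaf ⟨⟨7, 2, 2, 2, -1, 0⟩, ⟨7, 0, 2, 2, 1, 0⟩, ⟨12, 4, 2, 0, -1, 0⟩⟩)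
  | q1 =>
    .split ⟨0, 0, 0, 0, -1, 0⟩
     (.split ⟨0, 1, 0, -1, 0, 0⟩
      (.leaf ⟨⟨9, 2, 0, 2, -1, 0⟩, ⟨5, 0, 0, 2, -1, 0⟩, ⟨16, 0, 4, 4, -1, 0⟩⟩)
      (.leaf ⟨⟨9, 2, 0, 2, -1, 0⟩, ⟨5, 0, 0, 2, -1, 0⟩, ⟨20, 4, 4, 0, -1, 0⟩⟩))
     (.split ⟨2, 0, 0, 2, -1, 0⟩
      (.split ⟨0, 2, 0, -2, 1, 0⟩
       (.leaf ⟨⟨7, 2, 0, 2, 1, 0⟩, ⟨5, 0, 0, 2, -1, 0⟩, ⟨16, 0, 4, 4, -1, 0⟩⟩)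
       (.split ⟨2, 0, 0, 0, -1, 0⟩
        (.leaf ⟨⟨7, 2, 0, 2, 1, 0⟩, ⟨5, 0, 0, 2, -1, 0⟩, ⟨18, 4, 4, 0, 1, 0⟩⟩)
        (.leaf ⟨⟨7, 2, 0, 2, 1, 0⟩, ⟨5, 0, 0, 2, -1, 0⟩, ⟨16, 4, 4, 0, 1, 0⟩⟩)))
      (.split ⟨4, 0, 0, 2, -1, 0⟩
       (.leaf ⟨⟨7, 2, 0, 2, 1, 0⟩, ⟨-1, 0, 0, -2, 1, 0⟩, ⟨16, 0, 4, 4, -1, 0⟩⟩)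
       (.split ⟨6, 0, 2, 4, -1, 0⟩
        (.split ⟨10, 0, 4, 2, -1, 0⟩
         (.leaf ⟨⟨7, 2, 0, 2, 1, 0⟩, ⟨-3, 0, 0, -2, 1, 0⟩, ⟨16, 0, 4, 4, -1, 0⟩⟩)
         (.leaf ⟨⟨29, 2, 8, 6, -1, 0⟩, ⟨-3, 0, 0, -2, 1, 0⟩, ⟨16, 0, 4, 4, -1, 0⟩⟩))
        (.split ⟨1, 0, 1, -1, 0, 0⟩
         (.leaf ⟨⟨7, 2, 0, 2, 1, 0⟩, ⟨-3, 0, 0, -2, 1, 0⟩, ⟨2, 0, 0, -4, 1, 0⟩⟩)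
         (.leaf ⟨⟨15, 2, 4, -2, 1, 0⟩, ⟨-3, 0, 0, -2, 1, 0⟩, ⟨2, 0, 0, -4, 1, 0⟩⟩)))))
  | q2 =>
    .split ⟨6, 0, 2, 4, -1, 0⟩
     (.split ⟨4, 0, 2, 4, -1, 0⟩
      (.split ⟨3, 0, 2, 2, -1, 0⟩
       (.split ⟨0, 0, 0, 0, -1, 0⟩
        (.split ⟨0, 1, 0, -1, 0, 0⟩
         (.leaf ⟨⟨3, 0, 0, 2, -1, 0⟩, ⟨11, 2, 0, 2, -1, 0⟩, ⟨18, 2, 4, 4, -1, 0⟩⟩)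
         (.leaf ⟨⟨3, 0, 0, 2, -1, 0⟩, ⟨11, 2, 0, 2, -1, 0⟩, ⟨22, 6, 4, 0, -1, 0⟩⟩))
        (.split ⟨0, 2, 0, -2, 1, 0⟩
         (.split ⟨0, 0, 0, 2, -1, 0⟩
          (.leaf ⟨⟨3, 0, 0, 2, -1, 0⟩, ⟨9, 2, 0, 2, 1, 0⟩, ⟨18, 2, 4, 4, -1, 0⟩⟩)
          (.split ⟨2, 0, 0, 2, -1, 0⟩
           (.leaf ⟨⟨1, 0, 0, -2, 1, 0⟩, ⟨9, 2, 0, 2, 1, 0⟩, ⟨18, 2, 4, 4, -1, 0⟩⟩)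
           (.leaf ⟨⟨-1, 0, 0, -2, 1, 0⟩, ⟨9, 2, 0, 2, 1, 0⟩, ⟨18, 2, 4, 4, -1, 0⟩⟩)))
         (.leaf ⟨⟨3, 0, 0, 2, -1, 0⟩, ⟨9, 2, 0, 2, 1, 0⟩, ⟨20, 6, 4, 0, 1, 0⟩⟩)))
       (.leaf ⟨⟨-1, 0, 0, -2, 1, 0⟩, ⟨17, 2, 4, 6, -1, 0⟩, ⟨18, 2, 4, 4, -1, 0⟩⟩))
      (.leaf ⟨⟨-1, 0, 0, -2, 1, 0⟩, ⟨7, 2, 0, -2, 1, 0⟩, ⟨18, 2, 4, 4, -1, 0⟩⟩))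
     (.leaf ⟨⟨-1, 0, 0, -2, 1, 0⟩, ⟨5, 2, 0, -2, 1, 0⟩, ⟨4, 2, 0, -4, 1, 0⟩⟩)
  | q3 =>
    .split ⟨1, 2, 0, -2, 1, 0⟩
     (.split ⟨2, 0, 2, 2, -1, 0⟩
      (.leaf ⟨⟨10, 2, 2, 2, 1, 0⟩, ⟨6, 0, 2, 2, 1, 0⟩, ⟨9, 0, 2, 4, -1, 0⟩⟩)
      (.split ⟨4, 0, 2, 2, -1, 0⟩
       (.leaf ⟨⟨10, 2, 2, 2, 1, 0⟩, ⟨12, 0, 6, 6, -1, 0⟩, ⟨9, 0, 2, 4, -1, 0⟩⟩)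
       (.leaf ⟨⟨20, 2, 6, 6, -1, 0⟩, ⟨12, 0, 6, 6, -1, 0⟩, ⟨9, 0, 2, 4, -1, 0⟩⟩)))
     (.leaf ⟨⟨10, 2, 2, 2, 1, 0⟩, ⟨6, 0, 2, 2, 1, 0⟩, ⟨13, 4, 2, 0, 1, 0⟩⟩)
  | r1 =>
    .split ⟨0, 0, 0, 0, -1, 0⟩
     (.split ⟨1, 0, 1, -1, 0, 0⟩
      (.leaf ⟨⟨16, 2, 2, 6, -1, 0⟩, ⟨6, 0, 2, 2, -1, 0⟩, ⟨9, 0, 2, 0, -1, 0⟩⟩)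
      (.leaf ⟨⟨22, 2, 6, 2, -1, 0⟩, ⟨6, 0, 2, 2, -1, 0⟩, ⟨9, 0, 2, 0, -1, 0⟩⟩))
     (.split ⟨4, 0, 2, 0, -1, 0⟩
      (.split ⟨3, 0, 2, -2, -1, 0⟩
       (.leaf ⟨⟨14, 2, 2, 6, 1, 0⟩, ⟨4, 0, 2, 2, 1, 0⟩, ⟨9, 0, 2, 0, -1, 0⟩⟩)
       (.leaf ⟨⟨22, 2, 6, 2, -1, 0⟩, ⟨4, 0, 2, 2, 1, 0⟩, ⟨9, 0, 2, 0, -1, 0⟩⟩))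
      (.leaf ⟨⟨12, 2, 2, 2, 1, 0⟩, ⟨4, 0, 2, 2, 1, 0⟩, ⟨9, 0, 2, 0, -1, 0⟩⟩))
  | r2 =>
    .split ⟨0, 0, 0, 0, -1, 0⟩
     (.leaf ⟨⟨8, 0, 2, 2, -1, 0⟩, ⟨14, 2, 2, 2, -1, 0⟩, ⟨11, 2, 2, 0, -1, 0⟩⟩)
     (.split ⟨2, 0, 0, 0, -1, 0⟩
      (.leaf ⟨⟨6, 0, 2, 2, 1, 0⟩, ⟨12, 2, 2, 2, 1, 0⟩, ⟨11, 2, 2, 0, -1, 0⟩⟩)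
      (.leaf ⟨⟨6, 0, 2, 2, 1, 0⟩, ⟨10, 2, 2, 2, 1, 0⟩, ⟨11, 2, 2, 0, -1, 0⟩⟩))
  | r3 =>
    .split ⟨0, 1, 0, -1, 0, 0⟩
     (.leaf ⟨⟨8, 2, 2, 2, -1, 0⟩, ⟨6, 0, 2, 2, -1, 0⟩, ⟨11, 0, 2, 4, 1, 0⟩⟩)
     (.leaf ⟨⟨8, 2, 2, 2, -1, 0⟩, ⟨6, 0, 2, 2, -1, 0⟩, ⟨13, 4, 2, 0, 1, 0⟩⟩)
  | s1 =>
    .split ⟨0, 1, 0, -1, 0, 0⟩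
     (.split ⟨2, 2, 0, 0, -1, 0⟩
      (.leaf ⟨⟨2, 0, 0, 2, 1, 0⟩, ⟨8, 2, 0, 2, -1, 0⟩, ⟨17, 2, 4, 4, -1, 0⟩⟩)
      (.leaf ⟨⟨2, 0, 0, 2, 1, 0⟩, ⟨8, 2, 0, 2, -1, 0⟩, ⟨11, -2, 4, 4, 1, 0⟩⟩))
     (.split ⟨2, 2, 0, 0, -1, 0⟩
      (.leaf ⟨⟨2, 0, 0, 2, 1, 0⟩, ⟨8, 2, 0, 2, -1, 0⟩, ⟨19, 6, 4, 0, -1, 0⟩⟩)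
      (.leaf ⟨⟨2, 0, 0, 2, 1, 0⟩, ⟨8, 2, 0, 2, -1, 0⟩, ⟨13, 2, 4, 0, 1, 0⟩⟩))
  | s2 =>
    .split ⟨2, 2, 0, 0, -1, 0⟩
     (.leaf ⟨⟨11, 0, 4, 2, 1, 0⟩, ⟨13, 2, 4, 2, -1, 0⟩, ⟨4, 2, 0, 0, -1, 0⟩⟩)
     (.leaf ⟨⟨11, 0, 4, 2, 1, 0⟩, ⟨13, 2, 4, 2, -1, 0⟩, ⟨6, 2, 0, 0, -1, 0⟩⟩)
  | s3 =>
    .split ⟨0, 2, 0, -2, -1, 0⟩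
     (.leaf ⟨⟨8, 2, 2, 2, -1, 0⟩, ⟨8, 0, 2, 2, 1, 0⟩, ⟨9, 0, 2, 4, 1, 0⟩⟩)
     (.leaf ⟨⟨8, 2, 2, 2, -1, 0⟩, ⟨8, 0, 2, 2, 1, 0⟩, ⟨11, 4, 2, 0, -1, 0⟩⟩)
  | t1 =>
    .split ⟨2, 0, 0, 2, -1, 0⟩
     (.split ⟨1, 2, 0, -2, 1, 0⟩
      (.leaf ⟨⟨7, 2, 0, 2, 1, 0⟩, ⟨3, 0, 0, 2, -1, 0⟩, ⟨14, 0, 4, 4, -1, 0⟩⟩)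
      (.split ⟨0, 0, 0, 0, -1, 0⟩
       (.leaf ⟨⟨7, 2, 0, 2, 1, 0⟩, ⟨3, 0, 0, 2, -1, 0⟩, ⟨18, 4, 4, 0, -1, 0⟩⟩)
       (.leaf ⟨⟨7, 2, 0, 2, 1, 0⟩, ⟨3, 0, 0, 2, -1, 0⟩, ⟨16, 4, 4, 0, 1, 0⟩⟩)))
     (.split ⟨9, 0, 4, 2, -1, 0⟩
      (.leaf ⟨⟨7, 2, 0, 2, 1, 0⟩, ⟨-3, 0, 0, -2, 1, 0⟩, ⟨14, 0, 4, 4, -1, 0⟩⟩)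
      (.leaf ⟨⟨27, 2, 8, 6, -1, 0⟩, ⟨-3, 0, 0, -2, 1, 0⟩, ⟨14, 0, 4, 4, -1, 0⟩⟩))
  | t2 =>
    .split ⟨0, 0, 0, 2, -1, 0⟩
     (.split ⟨1, 2, 0, -2, 1, 0⟩
      (.leaf ⟨⟨1, 0, 0, 2, -1, 0⟩, ⟨9, 2, 0, 2, 1, 0⟩, ⟨16, 2, 4, 4, -1, 0⟩⟩)
      (.leaf ⟨⟨1, 0, 0, 2, -1, 0⟩, ⟨9, 2, 0, 2, 1, 0⟩, ⟨20, 6, 4, 0, 1, 0⟩⟩))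
     (.split ⟨2, 0, 2, 2, -1, 0⟩
      (.leaf ⟨⟨-1, 0, 0, -2, 1, 0⟩, ⟨9, 2, 0, 2, 1, 0⟩, ⟨16, 2, 4, 4, -1, 0⟩⟩)
      (.split ⟨4, 0, 2, 4, -1, 0⟩
       (.leaf ⟨⟨-1, 0, 0, -2, 1, 0⟩, ⟨15, 2, 4, 6, -1, 0⟩, ⟨16, 2, 4, 4, -1, 0⟩⟩)
       (.leaf ⟨⟨-1, 0, 0, -2, 1, 0⟩, ⟨5, 2, 0, -2, 1, 0⟩, ⟨16, 2, 4, 4, -1, 0⟩⟩)))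
  | t3 =>
    .split ⟨1, 2, 0, -2, 1, 0⟩
     (.split ⟨2, 0, 2, 2, -1, 0⟩
      (.leaf ⟨⟨9, 2, 2, 2, 1, 0⟩, ⟨7, 0, 2, 2, 1, 0⟩, ⟨8, 0, 2, 4, -1, 0⟩⟩)
      (.split ⟨4, 0, 2, 2, -1, 0⟩
       (.leaf ⟨⟨9, 2, 2, 2, 1, 0⟩, ⟨13, 0, 6, 6, -1, 0⟩, ⟨8, 0, 2, 4, -1, 0⟩⟩)
       (.leaf ⟨⟨19, 2, 6, 6, -1, 0⟩, ⟨13, 0, 6, 6, -1, 0⟩, ⟨8, 0, 2, 4, -1, 0⟩⟩)))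
     (.leaf ⟨⟨9, 2, 2, 2, 1, 0⟩, ⟨7, 0, 2, 2, 1, 0⟩, ⟨12, 4, 2, 0, 1, 0⟩⟩)
  | u1 =>
    .split ⟨2, 0, 2, -2, -1, 0⟩
     (.leaf ⟨⟨14, 2, 2, 6, 1, 0⟩, ⟨4, 0, 2, 2, 1, 0⟩, ⟨7, 0, 2, 0, -1, 0⟩⟩)
     (.split ⟨0, 0, 0, -1, 0, 0⟩
      (.leaf ⟨⟨12, 2, 2, 6, 1, 0⟩, ⟨4, 0, 2, 2, 1, 0⟩, ⟨7, 0, 2, 0, -1, 0⟩⟩)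
      (.leaf ⟨⟨20, 2, 6, 2, -1, 0⟩, ⟨4, 0, 2, 2, 1, 0⟩, ⟨7, 0, 2, 0, -1, 0⟩⟩))
  | u2 =>
    .split ⟨0, 0, 0, 0, -1, 0⟩
     (.leaf ⟨⟨6, 0, 2, 2, 1, 0⟩, ⟨12, 2, 2, 2, -1, 0⟩, ⟨9, 2, 2, 0, -1, 0⟩⟩)
     (.leaf ⟨⟨6, 0, 2, 2, 1, 0⟩, ⟨10, 2, 2, 2, 1, 0⟩, ⟨9, 2, 2, 0, -1, 0⟩⟩)
  | u3 =>
    .split ⟨0, 1, 0, -1, 0, 0⟩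
     (.leaf ⟨⟨9, 2, 2, 2, -1, 0⟩, ⟨5, 0, 2, 2, -1, 0⟩, ⟨10, 0, 2, 4, 1, 0⟩⟩)
     (.leaf ⟨⟨9, 2, 2, 2, -1, 0⟩, ⟨5, 0, 2, 2, -1, 0⟩, ⟨14, 4, 2, 0, 1, 0⟩⟩)

lemma resolving_even : resolving (sizeOfParity 0) (t2, ⟨1, 0, 0, 2⟩) (t1, ⟨3, 0, 0, 2⟩)
    (p2, ⟨5, 2, 0, 0⟩) evenTree = true := by
  decide +kernel

lemma resolving_odd : resolving (sizeOfParity 1) (t2, ⟨2, 0, 0, 2⟩) (t1, ⟨4, 0, 0, 2⟩)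
    (p2, ⟨5, 2, 0, 0⟩) oddTree = true := by
  decide +kernel

end Coronoid

/-! ### The symmetry that exchanges `b` and `c` -/

lemma SimpleGraph.dist_map_le {V W : Type*} {G : SimpleGraph V} {H : SimpleGraph W} (φ : G ≃g H)
    (x y : V) : H.dist (φ x) (φ y) ≤ G.dist x y := by
  by_cases h : G.Reachable x y
  · obtain ⟨p, hp⟩ := h.exists_walk_length_eq_dist
    rw [← hp, ← SimpleGraph.Walk.length_map φ.toHom p]
    exact SimpleGraph.dist_le _
  · rw [SimpleGraph.dist_eq_zero_of_not_reachable (mt φ.reachable_iff.1 h)]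
    exact Nat.zero_le _

lemma SimpleGraph.dist_map {V W : Type*} {G : SimpleGraph V} {H : SimpleGraph W} (φ : G ≃g H)
    (x y : V) : H.dist (φ x) (φ y) = G.dist x y := by
  refine le_antisymm (dist_map_le φ x y) ?_
  simpa using dist_map_le φ.symm (φ x) (φ y)

lemma SimpleGraph.metricDim_le_of_iso {V W : Type*} {G : SimpleGraph V} {H : SimpleGraph W}
    (φ : G ≃g H) : H.metricDim ≤ G.metricDim := by
  refine le_iInf₂ fun U hU => ?_
  refine (iInf₂_le (φ '' U) fun x y hxy => ?_).trans (Set.encard_image_le _ _)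
  obtain ⟨u, hu, hne⟩ := hU (φ.symm x) (φ.symm y) (φ.symm.injective.ne hxy)
  refine ⟨φ u, Set.mem_image_of_mem _ hu, ?_⟩
  rw [← SimpleGraph.dist_map φ, ← SimpleGraph.dist_map φ] at hne
  simpa using hne

namespace Coronoid

open FCSLine

/-- The effect on the families of the reflection of the coronoid that exchanges `b` and `c`. -/
def swapLine : FCSLine → FCSLine
  | p1 => p2 | p2 => p1 | s1 => s2 | s2 => s1 | q1 => r1 | r1 => q1 | q2 => r2 | r2 => q2
  | t1 => u1 | u1 => t1 | t2 => u2 | u2 => t2 | r3 => t3 | t3 => r3 | u3 => q3 | q3 => u3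
  | p3 => s3 | s3 => p3

/-- The families on which the reflection reverses the order of the vertices. -/
def isReversed : FCSLine → Bool
  | q1 | r1 | q2 | r2 | t1 | u1 | t2 | u2 => true
  | _ => false

variable {a b c : ℕ}

/-- The reflection on pairs of a family and a position. -/
def swapPos (a b c : ℕ) (v : FCSLine × ℕ) : FCSLine × ℕ :=
  (swapLine v.1, bif isReversed v.1 then v.1.len a b c + 1 - v.2 else v.2)

lemma swapPos_mem {v : FCSLine × ℕ} (h : 1 ≤ v.2 ∧ v.2 ≤ v.1.len a b c) :
    1 ≤ (swapPos a b c v).2 ∧ (swapPos a b c v).2 ≤ (swapPos a b c v).1.len a c b := by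
  obtain ⟨L, d⟩ := v
  cases L <;> simp only [swapPos, swapLine, isReversed, FCSLine.len, cond_true, cond_false] at * <;>
    omega

lemma swapPos_swapPos {v : FCSLine × ℕ} (h : 1 ≤ v.2 ∧ v.2 ≤ v.1.len a b c) :
    swapPos a c b (swapPos a b c v) = v := by
  obtain ⟨L, d⟩ := v
  cases L <;> simp only [swapPos, swapLine, isReversed, FCSLine.len, cond_true, cond_false,
    Prod.mk.injEq, true_and] at * <;> omega

lemma edge_swapPos (hb : 4 ≤ b) (hc : 4 ≤ c) {v v' : FCSLine × ℕ}
    (h : FCSEdge a b c v v') :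
    FCSEdge a c b (swapPos a b c v) (swapPos a b c v') ∨
      FCSEdge a c b (swapPos a b c v') (swapPos a b c v) := by
  have congr : ∀ {L M : FCSLine} {d e d' e' : ℕ}, FCSEdge a c b (L, d) (M, e) → d = d' → e = e' →
      FCSEdge a c b (L, d') (M, e') := by
    rintro L M d e _ _ h rfl rfl
    exact h
  have rung : ∀ {n d : ℕ}, 1 ≤ d → d ≤ n - 1 → 2 * (n - d) = 2 * n - 1 + 1 - 2 * d ∧
      2 * (n - d) - 1 = 2 * n - 3 + 1 - (2 * d - 1) := by omega
  cases h with
  | path x d h₁ h₂ =>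
    cases x <;> simp only [swapPos, swapLine, isReversed, FCSLine.len, cond_true, cond_false] at * <;>
    first
      | exact .inl (.path _ _ h₁ h₂)
      | exact .inr (congr (.path _ _ (by omega) (by simp only [FCSLine.len]; omega)) rfl (by omega))
  | p1s1 d h₁ h₂ => exact .inl (.p2s2 d h₁ h₂)
  | p2s2 d h₁ h₂ => exact .inl (.p1s1 d h₁ h₂)
  | q1t1 d h₁ h₂ =>
    exact .inl (congr (.r1u1 (c - d) (by omega) (by omega)) (rung h₁ h₂).1 (rung h₁ h₂).2)
  | q2t2 d h₁ h₂ =>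
    exact .inl (congr (.r2u2 (c - d) (by omega) (by omega)) (rung h₁ h₂).1 (rung h₁ h₂).2)
  | r1u1 d h₁ h₂ =>
    exact .inl (congr (.q1t1 (b - d) (by omega) (by omega)) (rung h₁ h₂).1 (rung h₁ h₂).2)
  | r2u2 d h₁ h₂ =>
    exact .inl (congr (.q2t2 (b - d) (by omega) (by omega)) (rung h₁ h₂).1 (rung h₁ h₂).2)
  | p3s3 d h₁ h₂ => exact .inr (.p3s3 d h₁ h₂)
  | q3t3 d h₁ h₂ => exact .inr (.r3u3 d h₁ h₂)
  | r3u3 d h₁ h₂ => exact .inr (.q3t3 d h₁ h₂)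
  | _ =>
    simp only [swapPos, swapLine, isReversed, FCSLine.len, cond_true, cond_false]
    first
      | exact .inl (congr (by constructor) (by omega) (by omega))
      | exact .inr (congr (by constructor) (by omega) (by omega))

/-- The reflection that exchanges `b` and `c`. -/
def swapIso (hb : 4 ≤ b) (hc : 4 ≤ c) : FCS a b c ≃g FCS a c b where
  toFun v := ⟨swapPos a b c v.1, swapPos_mem v.2⟩
  invFun v := ⟨swapPos a c b v.1, swapPos_mem v.2⟩
  left_inv v := Subtype.ext (swapPos_swapPos v.2)
  right_inv v := Subtype.ext (swapPos_swapPos v.2)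
  map_rel_iff' := by
    have key : ∀ {b c : ℕ} (_ : 4 ≤ b) (_ : 4 ≤ c) (v v' : FCSVertex a b c), (FCS a b c).Adj v v' →
        (FCS a c b).Adj ⟨swapPos a b c v.1, swapPos_mem v.2⟩
          ⟨swapPos a b c v'.1, swapPos_mem v'.2⟩ := fun {b c} hb hc v v' h => by
      obtain ⟨hne, h⟩ := (SimpleGraph.fromRel_adj ..).1 h
      refine (SimpleGraph.fromRel_adj ..).2 ⟨fun heq => hne (Subtype.ext ?_), ?_⟩
      · rw [← swapPos_swapPos v.2, ← swapPos_swapPos v'.2]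
        exact congrArg _ (congrArg Subtype.val heq)
      · exact h.elim (edge_swapPos hb hc) fun h => (edge_swapPos hb hc h).symm
    intro v v'
    refine ⟨fun h => ?_, key hb hc v v'⟩
    have back : ∀ v : FCSVertex a b c, (⟨swapPos a c b (swapPos a b c v.1),
        swapPos_mem (swapPos_mem v.2)⟩ : FCSVertex a b c) = v := fun v =>
      Subtype.ext (swapPos_swapPos v.2)
    rw [← back v, ← back v']
    exact key hc hb _ _ h

/-! ### The metric dimension -/

lemma three_le_metricDim (w : Params) : 3 ≤ (graph sizeC w).metricDim := by
  refine le_iInf₂ fun U hU => ?_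
  by_contra hlt
  have hsub : ∃ x y, U ⊆ {x, y} := by
    by_contra! hcon
    have hne : U.Nonempty := by
      rw [Set.nonempty_iff_ne_empty]
      rintro rfl
      let x : FCSVertex (4 + w.x) (4 + w.y) (sizeC.eval w) :=
        vert p1 1 ⟨le_refl 1, by simp only [len, FCSLine.len]; omega⟩
      exact hcon x x (Set.empty_subset _)
    obtain ⟨x, hx⟩ := hne
    obtain ⟨y, hy, hyx⟩ := Set.not_subset.1 (hcon x x)
    obtain ⟨z, hz, hzxy⟩ := Set.not_subset.1 (hcon x y)
    simp only [Set.mem_insert_iff, Set.mem_singleton_iff, not_or] at hyx hzxy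
    have h3 : ({x, y, z} : Set _).encard = 3 :=
      Set.encard_eq_three.2 ⟨x, y, z, Ne.symm hyx.1, Ne.symm hzxy.1, Ne.symm hzxy.2, rfl⟩
    refine hlt (h3 ▸ Set.encard_le_encard ?_)
    rintro t (rfl | rfl | rfl) <;> assumption
  obtain ⟨x, y, hxy⟩ := hsub
  obtain ⟨v, v', hne, h1, h2⟩ := exists_unresolved x y
  obtain ⟨u, hu, hd⟩ := hU v v' hne
  rcases hxy hu with rfl | rfl
  · exact hd h1
  · exact hd h2

lemma metricDim_le_three_of_resolving {C : Form} {w : Params} (hC : 4 ≤ C.c) {p₁ p₂ p₃ : Point}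
    {t : FCSLine → Tree Values} (ht : resolving C p₁ p₂ p₃ t = true) :
    (graph C w).metricDim ≤ 3 := by
  have hr := ht
  simp only [resolving, closedAll, closed, Bool.and_eq_true] at hr
  obtain ⟨⟨⟨⟨⟨h₁, -⟩, -⟩, ⟨⟨h₂, -⟩, -⟩, ⟨⟨h₃, -⟩, -⟩⟩, -⟩, -⟩ := hr
  refine (iInf₂_le _ (isMetricGenerator_of_resolving hC ht h₁ h₂ h₃)).trans ?_
  refine (Set.encard_insert_le _ _).trans ?_
  have h := Set.encard_insert_le {vertAt (w := w) hC h₃} (vertAt hC h₂)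
  rw [Set.encard_singleton] at h
  calc _ ≤ (1 + 1 + 1 : ℕ∞) := by gcongr
    _ = 3 := by norm_num

lemma metricDim_of_le {a b c : ℕ} (ha : 4 ≤ a) (hb : 4 ≤ b) (hbc : b ≤ c) :
    (FCS a b c).metricDim = 3 := by
  obtain ⟨x, rfl⟩ := Nat.exists_eq_add_of_le ha
  obtain ⟨y, rfl⟩ := Nat.exists_eq_add_of_le hb
  obtain ⟨z, rfl⟩ := Nat.exists_eq_add_of_le hbc
  apply le_antisymm
  · obtain ⟨m, rfl | rfl⟩ := Nat.even_or_odd' z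
    · have h := metricDim_le_three_of_resolving (w := ⟨x, y, m⟩) (le_refl 4) resolving_even
      have e : (sizeOfParity 0).eval ⟨x, y, m⟩ = 4 + y + 2 * m := by
        simp [sizeOfParity, Form.eval]
      rwa [graph, e] at h
    · have h := metricDim_le_three_of_resolving (w := ⟨x, y, m⟩) (by decide : 4 ≤ 5)
        resolving_odd
      have e : (sizeOfParity 1).eval ⟨x, y, m⟩ = 4 + y + (2 * m + 1) := by
        simp [sizeOfParity, Form.eval]; omega
      rwa [graph, e] at h
  · have h := three_le_metricDim ⟨x, y, z⟩
    have e : sizeC.eval ⟨x, y, z⟩ = 4 + y + z := by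
      simp [sizeC, Form.eval]
    rwa [graph, e] at h

end Coronoid

theorem theorem1 (a b c : ℕ) (ha : 4 ≤ a) (hb : 4 ≤ b) (hc : 4 ≤ c) :
    (FCS a b c).metricDim = 3 := by
  rcases le_total b c with h | h
  · exact Coronoid.metricDim_of_le ha hb h
  · rw [← Coronoid.metricDim_of_le ha hc h]
    exact le_antisymm (SimpleGraph.metricDim_le_of_iso (Coronoid.swapIso hc hb))
      (SimpleGraph.metricDim_le_of_iso (Coronoid.swapIso hb hc))
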